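/- For a simple graph $G$ on $n$ vertices with adjacency matrix $A(G)$ and degree matrix $D(G)$, let $Q(G)=D(G)+A(G)$ and define the signless Laplacian coefficients $\varphi_0(G),\dots,\varphi_n(G)$ by $$\det(xI-Q(G))=\sum_{i=0}^{n}(-1)^i\varphi_i(G)\,x^{n-i}.$$ Cycles are identified with their edge sets, and $V(C)$ denotes the vertex set of a cycle $C$. A minimum cycle basis of $G$ is a set of cycles that forms a basis of the cycle space of $G$ over $\mathbb F_2$ and has the least possible total length. **Theorem 3.4.** Let $G$ be a finite connected simple graph with $n$ vertices, let $\mathcal B$ be a minimum cycle basis of $G$, and let $C_1$ be a cycle of $G$ of length at least $5$. Let $uv$ and $vw$ be two consecutive edges of $C_1$ such that $$N_G(u)\cap N_G(v)=\emptyset,\qquad N_G(v)\cap N_G(w)=\emptyset,\qquad N_G(u)\cap N_G(w)=\{v\}.$$ Suppose that every cycle $C\in\mathcal B$ with $C\neq C_1$ satisfies: 1. if $|V(C_1)\cap V(C)|\le 2$, then $|\{u,v,w\}\cap V(C)|\in\{0,1\}$; 2. if $|V(C_1)\cap V(C)|=3$, then $|\{u,v,w\}\cap V(C)|\in\{0,3\}$;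 3. if $|V(C_1)\cap V(C)|\ge 4$, then $|\{u,v,w\}\cap V(C)|=3$. Let $G'$ be the graph obtained from $G$ by deleting all edges at $w$ and all edges at $v$ except $uv$, and joining $u$ to $w$, to every vertex of $N_G(w)\setminus\{v\}$ and to every vertex of $N_G(v)\setminus\{u,w\}$. Then $G'$ has a cycle with vertex set $V(C_1)\setminus\{v,w\}$, whose length is $|C_1|-2$, and $$\varphi_i(G)\ge\varphi_i(G')\qquad\text{for all } i=0,1,\dots,n,$$ with equality if and only if $i\in\{0,1\}$, or $i=n$ and every odd cycle of $G$ contains the edge $uv$ (in particular, equality holds for $i=n$ when $G$ is bipartite). Hence $\varphi_i(G)>\varphi_i(G')$ for all $2\le i\le n-1$. -/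

import Mathlib

/-- The `i`-th signless Laplacian coefficient `φ_i(G)`, where
`det(xI - Q(G)) = ∑_{i=0}^{n} (-1)^i φ_i(G) x^{n-i}`, `Q(G) = D(G) + A(G)` and `n = |V|`
(meaningful for `i ≤ n`). -/
noncomputable def signlessLaplacianCoeff {V : Type*} [Fintype V] [DecidableEq V]
    (G : SimpleGraph V) (i : ℕ) : ℤ :=
  open Classical in
  (-1) ^ i * (G.degMatrix ℤ + G.adjMatrix ℤ).charpoly.coeff (Fintype.card V - i)

/-- `C` is the edge set of a cycle of `G`. A cycle is identified with its edge set, so its length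
is `C.card`. -/
def IsCycleOf {V : Type*} [DecidableEq V] (G : SimpleGraph V) (C : Finset (Sym2 V)) : Prop :=
  ∃ (x : V) (p : G.Walk x x), p.IsCycle ∧ p.edges.toFinset = C

/-- The vertex set `V(C)` of a set of edges `C`. -/
def cycleVerts {V : Type*} [Fintype V] [DecidableEq V] (C : Finset (Sym2 V)) : Finset V :=
  Finset.univ.filter fun x => ∃ e ∈ C, x ∈ e

/-- The incidence vector over the field with two elements of a set of edges. -/
def edgeVector {V : Type*} [DecidableEq V] (C : Finset (Sym2 V)) : Sym2 V → ZMod 2 :=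
  fun e => if e ∈ C then 1 else 0

/-- `B` is a set of cycles of `G` whose incidence vectors form a basis of the cycle space of `G`
(the `𝔽₂`-span of the incidence vectors of all cycles of `G`). -/
def IsCycleBasis {V : Type*} [DecidableEq V] (G : SimpleGraph V)
    (B : Finset (Finset (Sym2 V))) : Prop :=
  (∀ C ∈ B, IsCycleOf G C) ∧
  LinearIndepOn (ZMod 2) edgeVector (B : Set (Finset (Sym2 V))) ∧
  ∀ C, IsCycleOf G C →
    edgeVector C ∈ Submodule.span (ZMod 2) (edgeVector '' (B : Set (Finset (Sym2 V))))

/-- A cycle basis of least total length. -/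
def IsMinimumCycleBasis {V : Type*} [DecidableEq V] (G : SimpleGraph V)
    (B : Finset (Finset (Sym2 V))) : Prop :=
  IsCycleBasis G B ∧ ∀ B', IsCycleBasis G B' → ∑ C ∈ B, C.card ≤ ∑ C ∈ B', C.card

/-- The graph obtained from `G` by deleting every edge at `w` and every edge at `v` other than
`uv`, and joining `u` to every neighbour of `v` other than `u` (among them `w`) and to every
neighbour of `w` other than `v`. -/
def moveEdges {V : Type*} (G : SimpleGraph V) (u v w : V) : SimpleGraph V :=
  SimpleGraph.fromEdgeSet
    ((G.edgeSet \
      ({e | ∃ x ∈ G.neighborSet w, e = s(w, x)} ∪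
        {e | ∃ x ∈ G.neighborSet v \ {u}, e = s(v, x)})) ∪
      ({e | ∃ x ∈ G.neighborSet w \ {v}, e = s(u, x)} ∪
        {e | ∃ x ∈ G.neighborSet v \ {u}, e = s(u, x)}))

open Matrix Polynomial

/-! ### Sums of principal minors -/

/-! The numbers φ_k are the coefficients of t^k in det(1 + tQ), so the two graphs are compared
through these determinants. Let H be G without the edges uv and vw (`cutGraph`).

Combinatorial input. Cycles of a minimum basis have no chords (`IsMinimumCycleBasis.mem_of_adj`), so
the conditions on {u, v, w} ∩ V(C) force every basis cycle to contain both or neither of uv and vw.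
This is a linear condition over 𝔽₂ and so passes to all cycles. Hence H separates v from u and w,
while C₁ keeps u and w together: H has exactly two components.

Algebraic input. Q(G) is Q(H) plus the matrix of the path u-v-w; Q(G') is Q(H) with v and w merged
into u, plus the matrix of the star centred at u. Writing Q(H) = BBᵀ and expanding over sets F of
columns (`det_one_add_map_eq_sum`), F contributes t^|F| det(B_FᵀB_F) times a 3×3 determinant in the
entries at u, v, w of the projection Π onto the orthogonal complement of the columns of B_F. Put a =
Π_uu, b = Π_ww, c = Π_uw, d = Π_vv. Separation gives Π_vu = Π_vw = 0, the t² terms cancel in the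
difference, and `lowExcess` + t · `highExcess` remains. Both are nonnegative because 1 - (a + b -
2c) + (ab - c²) ≥ 0 (`edgeProj_inner_nonneg`); the delicate case c < 0 uses that u and w are at
distance at least three in H.

Equality. For 2 ≤ k ≤ n - 1 an independent F with k - 1 edges and 0 < a < 1 gives strictness. For k
= n only sets with at least n - 1 edges matter. If H has no odd cycle, each of its two components
adds at least 1 to the trace n - |F| of Π, so no such independent set exists. An odd cycle in H
supplies one with positive excess. -/

theorem Matrix.eval_det_one_add_X_smul {n : Type*} [Fintype n] [DecidableEq n]
    (M : Matrix n n ℝ) (t : ℝ) :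
    (det (1 + (X : ℝ[X]) • M.map C)).eval t = det (1 + t • M) := by
  rw [← coe_evalRingHom, RingHom.map_det]
  congr 1
  ext i j
  by_cases h : i = j <;> simp [h, mul_comm t]

theorem Matrix.natDegree_det_one_add_X_smul_le {n : Type*} [Fintype n] [DecidableEq n]
    (M : Matrix n n ℝ) :
    (det (1 + (X : ℝ[X]) • M.map C)).natDegree ≤ Fintype.card n := by
  rw [Polynomial.natDegree_le_iff_coeff_eq_zero]
  intro k hk
  rw [coeff_det_one_add_X_smul_eq_sum_minors, Finset.powersetCard_eq_empty.2 (by simpa using hk),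
    Finset.sum_empty]

theorem Matrix.det_one_add_smul_eq_sum_minors {n : Type*} [Fintype n] [DecidableEq n]
    (M : Matrix n n ℝ) (t : ℝ) :
    det (1 + t • M) =
      ∑ s : Finset n, t ^ s.card *
        (M.submatrix (Subtype.val : s → n) (Subtype.val : s → n)).det := by
  rw [← eval_det_one_add_X_smul, Polynomial.eval_eq_sum_range'
    (Nat.lt_succ_of_le (natDegree_det_one_add_X_smul_le M)), ← Finset.powerset_univ,
    Finset.sum_powerset]
  refine Finset.sum_congr rfl fun k _ => ?_
  rw [coeff_det_one_add_X_smul_eq_sum_minors, Finset.sum_mul]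
  refine Finset.sum_congr rfl fun s hs => ?_
  rw [(Finset.mem_powersetCard.1 hs).2, mul_comm]

/-! ### The matrix of a map -/

/-- The matrix of the linear map that sends the basis vector of `x` to the basis vector of
`f x`. -/
def mapMatrix {α V : Type*} [DecidableEq V] (f : α → V) : Matrix V α ℝ :=
  Matrix.of fun y x => if f x = y then 1 else 0

theorem mapMatrix_transpose_mul {α V β : Type*} [Fintype V] [DecidableEq V] (f : α → V)
    (M : Matrix V β ℝ) : (mapMatrix f)ᵀ * M = M.submatrix f id := by
  ext x y
  simp [mapMatrix, Matrix.mul_apply]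

theorem mul_mapMatrix {α V β : Type*} [Fintype V] [DecidableEq V] (f : α → V)
    (M : Matrix β V ℝ) : M * mapMatrix f = M.submatrix id f := by
  ext x y
  simp [mapMatrix, Matrix.mul_apply]

/-- The signless Laplacian of a weighted graph. -/
def signlessLaplacian {V : Type*} [Fintype V] [DecidableEq V] (A : Matrix V V ℝ) :
    Matrix V V ℝ :=
  Matrix.diagonal (fun x => ∑ y, A x y) + A

theorem signlessLaplacian_add {V : Type*} [Fintype V] [DecidableEq V] (A A' : Matrix V V ℝ) :
    signlessLaplacian (A + A') = signlessLaplacian A + signlessLaplacian A' := by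
  ext x y
  simp only [signlessLaplacian, Matrix.add_apply, Matrix.diagonal_apply, Finset.sum_add_distrib]
  split_ifs <;> ring

/-- Merging vertices adds up their row sums, so pushing forward commutes with forming the degree
diagonal. Edges inside a fibre become diagonal entries, so no injectivity is needed. -/
theorem signlessLaplacian_map {α V : Type*} [Fintype α] [DecidableEq α] [Fintype V]
    [DecidableEq V] (f : α → V) (A : Matrix α α ℝ) :
    signlessLaplacian (mapMatrix f * A * (mapMatrix f)ᵀ) =
      mapMatrix f * signlessLaplacian A * (mapMatrix f)ᵀ := by
  have hdiag : mapMatrix f * Matrix.diagonal (fun x => ∑ y, A x y) * (mapMatrix f)ᵀ =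
      Matrix.diagonal (fun x => ∑ y, (mapMatrix f * A * (mapMatrix f)ᵀ) x y) := by
    ext x y
    have h1 : ∑ z, (mapMatrix f * A * (mapMatrix f)ᵀ) x z =
        ∑ i, mapMatrix f x i * ∑ j, A i j := by
      simp only [Matrix.mul_apply, Matrix.transpose_apply]
      rw [Finset.sum_comm]
      simp_rw [← Finset.mul_sum]
      simp only [mapMatrix, Matrix.of_apply, Finset.sum_ite_eq, Finset.mem_univ, if_true, mul_one]
      rw [Finset.sum_comm]
      simp_rw [Finset.mul_sum]
    rw [Matrix.diagonal_apply, h1, Matrix.mul_apply]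
    simp only [Matrix.mul_diagonal, Matrix.transpose_apply]
    split_ifs with h
    · subst h
      refine Finset.sum_congr rfl fun i _ => ?_
      simp only [mapMatrix, Matrix.of_apply]
      split_ifs <;> simp
    · refine Finset.sum_eq_zero fun i _ => ?_
      simp only [mapMatrix, Matrix.of_apply]
      split_ifs with h2 h3
      · exact absurd (h2.symm.trans h3) h
      all_goals simp
  rw [signlessLaplacian, ← hdiag, signlessLaplacian]
  simp only [Matrix.mul_add, Matrix.add_mul]

/-! ### The projection to the orthogonal complement of the columns -/

/-- The orthogonal projection to the complement of the column space (of a matrix with independent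
columns). -/
noncomputable def complProj {V κ : Type*} [Fintype V] [DecidableEq V] [Fintype κ] [DecidableEq κ]
    (A : Matrix V κ ℝ) : Matrix V V ℝ :=
  1 - A * (Aᵀ * A)⁻¹ * Aᵀ

section complProj

variable {V κ : Type*} [Fintype V] [DecidableEq V] [Fintype κ] [DecidableEq κ]
  {A : Matrix V κ ℝ}

theorem complProj_transpose (A : Matrix V κ ℝ) : (complProj A)ᵀ = complProj A := by
  simp [complProj, Matrix.transpose_mul, Matrix.transpose_nonsing_inv, Matrix.mul_assoc]

theorem complProj_comm (A : Matrix V κ ℝ) (x y : V) : complProj A x y = complProj A y x := by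
  conv_lhs => rw [← complProj_transpose A]
  rfl

theorem transpose_mul_complProj (hA : (Aᵀ * A).det ≠ 0) : Aᵀ * complProj A = 0 := by
  have hu : IsUnit (Aᵀ * A).det := isUnit_iff_ne_zero.2 hA
  rw [complProj, Matrix.mul_sub, Matrix.mul_one, ← Matrix.mul_assoc, ← Matrix.mul_assoc,
    Matrix.mul_nonsing_inv _ hu, Matrix.one_mul, sub_self]

theorem complProj_mulVec {y : V → ℝ} (hy : Aᵀ *ᵥ y = 0) : complProj A *ᵥ y = y := by
  rw [complProj, Matrix.sub_mulVec, ← Matrix.mulVec_mulVec, hy]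
  simp

theorem complProj_mul_self (hA : (Aᵀ * A).det ≠ 0) :
    complProj A * complProj A = complProj A := by
  conv_lhs => enter [1]; rw [complProj]
  rw [Matrix.sub_mul, Matrix.mul_assoc, transpose_mul_complProj hA]
  simp

/-- Symmetry and idempotence make a diagonal entry the squared norm of its row; all the entry bounds
used later come from this. -/
theorem complProj_diag (hA : (Aᵀ * A).det ≠ 0) (x : V) :
    complProj A x x = ∑ y, complProj A x y ^ 2 := by
  conv_lhs => rw [← complProj_mul_self hA, Matrix.mul_apply]
  exact Finset.sum_congr rfl fun y _ => by rw [complProj_comm A y x, sq]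

theorem sq_le_complProj_diag (hA : (Aᵀ * A).det ≠ 0) (x y : V) :
    complProj A x y ^ 2 ≤ complProj A x x := by
  rw [complProj_diag hA x]
  exact Finset.single_le_sum (f := fun y => complProj A x y ^ 2) (fun _ _ => sq_nonneg _)
    (Finset.mem_univ y)

theorem complProj_diag_nonneg (hA : (Aᵀ * A).det ≠ 0) (x : V) : 0 ≤ complProj A x x :=
  (sq_nonneg _).trans (sq_le_complProj_diag hA x x)

theorem complProj_diag_le_one (hA : (Aᵀ * A).det ≠ 0) (x : V) : complProj A x x ≤ 1 := by
  nlinarith [sq_le_complProj_diag hA x x, complProj_diag_nonneg hA x]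

theorem trace_complProj (hA : (Aᵀ * A).det ≠ 0) :
    (complProj A).trace = Fintype.card V - Fintype.card κ := by
  have hu : IsUnit (Aᵀ * A).det := isUnit_iff_ne_zero.2 hA
  rw [complProj, Matrix.trace_sub, Matrix.trace_one, Matrix.mul_assoc, Matrix.trace_mul_comm,
    Matrix.mul_assoc, Matrix.nonsing_inv_mul _ hu, Matrix.trace_one]

/-- After factoring out AᵀA, the identity det(1 + XY) = det(1 + YX) moves the determinant to the
small index type, where only the block of A(AᵀA)⁻¹Aᵀ at the chosen vertices survives. -/
theorem det_transpose_mul_mul {m : Type*} [Fintype m] [DecidableEq m]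
    (hA : (Aᵀ * A).det ≠ 0) (e : m → V) (he : Function.Injective e) (Z : Matrix m m ℝ) :
    (Aᵀ * (1 + mapMatrix e * Z * (mapMatrix e)ᵀ) * A).det =
      (Aᵀ * A).det * (1 + Z * (1 - (complProj A).submatrix e e)).det := by
  have hu : IsUnit (Aᵀ * A).det := isUnit_iff_ne_zero.2 hA
  have h1 : Aᵀ * (1 + mapMatrix e * Z * (mapMatrix e)ᵀ) * A =
      (Aᵀ * A) * (1 + ((Aᵀ * A)⁻¹ * Aᵀ * mapMatrix e) * (Z * ((mapMatrix e)ᵀ * A))) := by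
    rw [Matrix.mul_add, Matrix.mul_one, Matrix.mul_add, Matrix.add_mul, Matrix.mul_one]
    congr 1
    simp only [← Matrix.mul_assoc]
    rw [Matrix.mul_nonsing_inv _ hu, Matrix.one_mul]
  have h2 : 1 - (complProj A).submatrix e e =
      (mapMatrix e)ᵀ * (A * (Aᵀ * A)⁻¹ * Aᵀ) * mapMatrix e := by
    rw [mapMatrix_transpose_mul, mul_mapMatrix, Matrix.submatrix_submatrix]
    ext i j
    simp [complProj, Matrix.one_apply, he.eq_iff]
  rw [h1, Matrix.det_mul, Matrix.det_one_add_mul_comm, h2]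
  simp only [Matrix.mul_assoc]

theorem det_transpose_mul_mul_eq_zero (hA : (Aᵀ * A).det = 0) (M : Matrix V V ℝ) :
    (Aᵀ * M * A).det = 0 := by
  obtain ⟨x, hx, hx0⟩ := Matrix.exists_mulVec_eq_zero_iff.2 hA
  refine Matrix.exists_mulVec_eq_zero_iff.1 ⟨x, hx, ?_⟩
  have h : A *ᵥ x = 0 := by
    have h2 : (A *ᵥ x) ⬝ᵥ (A *ᵥ x) = 0 := by
      rw [Matrix.dotProduct_mulVec, ← Matrix.mulVec_transpose, Matrix.mulVec_mulVec, hx0,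
        zero_dotProduct]
    exact dotProduct_self_eq_zero.1 h2
  rw [← Matrix.mulVec_mulVec, h, Matrix.mulVec_zero]

end complProj

/-! ### Expansion of perturbed determinants over sets of columns -/

/-- The columns of `B` with index in `F`. -/
def columns {V ι : Type*} (B : Matrix V ι ℝ) (F : Finset ι) : Matrix V F ℝ :=
  B.submatrix id Subtype.val

/-- A rank-three perturbation of the Gram matrix expanded over the sets of columns. -/
theorem det_one_add_map_eq_sum {V ι m : Type*} [Fintype V] [DecidableEq V] [Fintype ι]
    [DecidableEq ι] [Fintype m] [DecidableEq m] (B : Matrix V ι ℝ) (e : m → V)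
    (he : Function.Injective e) (P : Matrix V V ℝ) (S Y Z : Matrix m m ℝ)
    (hY : (1 + S) * (1 + Y) = 1)
    (hZ : Pᵀ * (1 + mapMatrix e * Y * (mapMatrix e)ᵀ) * P =
      1 + mapMatrix e * Z * (mapMatrix e)ᵀ) (t : ℝ) :
    det (1 + t • (P * (B * Bᵀ) * Pᵀ) + mapMatrix e * S * (mapMatrix e)ᵀ) =
      ∑ F : Finset ι, t ^ F.card * (((columns B F)ᵀ * columns B F).det *
        (det (1 + S) * det (1 + Z * (1 - (complProj (columns B F)).submatrix e e)))) := by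
  have hee : (mapMatrix e)ᵀ * mapMatrix e = 1 := by
    rw [mapMatrix_transpose_mul]
    ext i j
    simp [mapMatrix, Matrix.one_apply, he.eq_iff, eq_comm]
  set E := mapMatrix e with hE
  -- As EᵀE = 1, an inverse of the small matrix 1 + S extends to the whole space. It is used to
  -- factor the perturbation out on the left.
  have hN : (1 + E * S * Eᵀ) * (1 + E * Y * Eᵀ) = 1 := by
    have h0 : S + Y + S * Y = 0 := by
      have : (1 + S) * (1 + Y) = 1 + (S + Y + S * Y) := by noncomm_ring
      rw [this] at hY
      simpa using hY
    have h1 : E * S * Eᵀ * (E * Y * Eᵀ) = E * (S * Y) * Eᵀ := by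
      calc E * S * Eᵀ * (E * Y * Eᵀ) = E * S * (Eᵀ * E) * Y * Eᵀ := by
            simp only [Matrix.mul_assoc]
        _ = _ := by rw [hee]; simp only [Matrix.mul_assoc, Matrix.mul_one]
    calc (1 + E * S * Eᵀ) * (1 + E * Y * Eᵀ)
        = 1 + (E * S * Eᵀ + E * Y * Eᵀ + E * S * Eᵀ * (E * Y * Eᵀ)) := by noncomm_ring
      _ = 1 + E * (S + Y + S * Y) * Eᵀ := by
          rw [h1]; simp only [Matrix.mul_add, Matrix.add_mul]
      _ = 1 := by rw [h0]; simp
  have hdet : det (1 + E * S * Eᵀ) = det (1 + S) := by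
    rw [Matrix.mul_assoc, Matrix.det_one_add_mul_comm, Matrix.mul_assoc, hee, Matrix.mul_one]
  have hfac : 1 + t • (P * (B * Bᵀ) * Pᵀ) + E * S * Eᵀ =
      (1 + E * S * Eᵀ) *
        (1 + ((1 + E * Y * Eᵀ) * P * B) * (t • (Bᵀ * Pᵀ))) := by
    rw [Matrix.mul_add, Matrix.mul_one]
    have : (1 + E * S * Eᵀ) * ((1 + E * Y * Eᵀ) * P * B * t • (Bᵀ * Pᵀ)) =
        t • (P * (B * Bᵀ) * Pᵀ) := by
      rw [Matrix.mul_smul, Matrix.mul_smul]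
      simp only [← Matrix.mul_assoc]
      rw [hN, Matrix.one_mul]
    rw [this]
    abel
  have hB : (t • (Bᵀ * Pᵀ)) * ((1 + E * Y * Eᵀ) * P * B) =
      t • (Bᵀ * (1 + E * Z * Eᵀ) * B) := by
    rw [← hZ, Matrix.smul_mul]
    simp only [Matrix.mul_assoc]
  rw [hfac, Matrix.det_mul, hdet, Matrix.det_one_add_mul_comm, hB,
    Matrix.det_one_add_smul_eq_sum_minors, Finset.mul_sum]
  refine Finset.sum_congr rfl fun F _ => ?_
  have hsub : (Bᵀ * (1 + E * Z * Eᵀ) * B).submatrix (Subtype.val : F → ι) Subtype.val =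
      (columns B F)ᵀ * (1 + E * Z * Eᵀ) * columns B F := by
    rfl
  rw [hsub]
  -- For dependent columns both sides vanish, so it does not matter that the inverse inside
  -- `complProj` is then a default value.
  by_cases hW : ((columns B F)ᵀ * columns B F).det = 0
  · rw [det_transpose_mul_mul_eq_zero hW, hW]
    ring
  · rw [det_transpose_mul_mul hW e he]
    ring

/-! ### Signless Laplacians of graphs -/

/-- The real adjacency matrix. -/
noncomputable def realAdj {V : Type*} (G : SimpleGraph V) : Matrix V V ℝ :=
  open Classical in Matrix.of fun x y => if G.Adj x y then 1 else 0

/-- The real incidence matrix. -/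
noncomputable def realInc {V : Type*} [DecidableEq V] (G : SimpleGraph V) :
    Matrix V (Sym2 V) ℝ :=
  open Classical in G.incMatrix ℝ

theorem realInc_mul_transpose {V : Type*} [Fintype V] [DecidableEq V] (G : SimpleGraph V) :
    realInc G * (realInc G)ᵀ = signlessLaplacian (realAdj G) := by
  classical
  rw [realInc, SimpleGraph.incMatrix_mul_transpose]
  ext x y
  by_cases h : x = y
  · subst h
    simp [signlessLaplacian, realAdj, ← SimpleGraph.card_neighborFinset_eq_degree,
      SimpleGraph.neighborFinset_eq_filter]
  · simp [signlessLaplacian, realAdj, h]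

/-- Both coefficients are sums of principal k × k minors; the sign in the definition of φ_k cancels
that of the characteristic polynomial. The bound on k keeps the subtraction n - k from truncating.
-/
theorem signlessLaplacianCoeff_eq_coeff {V : Type*} [Fintype V] [DecidableEq V]
    (G : SimpleGraph V) {k : ℕ} (hk : k ≤ Fintype.card V) :
    (signlessLaplacianCoeff G k : ℝ) =
      (det (1 + (X : ℝ[X]) • (signlessLaplacian (realAdj G)).map C)).coeff k := by
  classical
  rw [signlessLaplacianCoeff, charpoly_coeff_eq_sum_minors _ _ hk,
    coeff_det_one_add_X_smul_eq_sum_minors, ← mul_assoc, ← mul_pow]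
  simp only [mul_neg, mul_one, neg_neg, one_pow, one_mul, Int.cast_sum]
  refine Finset.sum_congr rfl fun s _ => ?_
  rw [← eq_intCast (Int.castRingHom ℝ), RingHom.map_det]
  congr 1
  ext i j
  by_cases h : i.1 = j.1
  · simp [signlessLaplacian, realAdj, SimpleGraph.degMatrix, SimpleGraph.adjMatrix, h,
      ← SimpleGraph.card_neighborFinset_eq_degree, SimpleGraph.neighborFinset_eq_filter]
  · simp [signlessLaplacian, realAdj, SimpleGraph.degMatrix, SimpleGraph.adjMatrix, h]

theorem moveEdges_adj {V : Type*} {G : SimpleGraph V} {u v w x y : V} (huv : u ≠ v)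
    (huw : u ≠ w) (hvw : v ≠ w) :
    (moveEdges G u v w).Adj x y ↔ x ≠ y ∧
      ((G.Adj x y ∧ x ≠ w ∧ y ≠ w ∧ (x = v → y = u) ∧ (y = v → x = u)) ∨
        (x = u ∧ (G.Adj w y ∧ y ≠ v ∨ G.Adj v y ∧ y ≠ u)) ∨
        (y = u ∧ (G.Adj w x ∧ x ≠ v ∨ G.Adj v x ∧ x ≠ u))) := by
  have hs := G.symm
  simp only [moveEdges, SimpleGraph.fromEdgeSet_adj, Set.mem_union, Set.mem_sdiff,
    Set.mem_ofPred_eq, SimpleGraph.mem_edgeSet, SimpleGraph.mem_neighborSet,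
    Set.mem_singleton_iff, Sym2.eq_iff]
  constructor
  · rintro ⟨h, hne⟩
    refine ⟨hne, ?_⟩
    rcases h with ⟨h1, h2⟩ | ⟨z, hz, h⟩ | ⟨z, hz, h⟩
    · left
      refine ⟨h1, ?_, ?_, ?_, ?_⟩
      · rintro rfl; exact h2 (Or.inl ⟨y, h1, by simp⟩)
      · rintro rfl; exact h2 (Or.inl ⟨x, h1.symm, by simp⟩)
      · rintro rfl; by_contra hy; exact h2 (Or.inr ⟨y, ⟨h1, hy⟩, by simp⟩)
      · rintro rfl; by_contra hy; exact h2 (Or.inr ⟨x, ⟨h1.symm, hy⟩, by simp⟩)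
    · right; rcases h with ⟨rfl, rfl⟩ | ⟨rfl, rfl⟩ <;> tauto
    · right; rcases h with ⟨rfl, rfl⟩ | ⟨rfl, rfl⟩ <;> tauto
  · rintro ⟨hne, h⟩
    refine ⟨?_, hne⟩
    rcases h with ⟨h1, h2, h3, h4, h5⟩ | ⟨rfl, h | h⟩ | ⟨rfl, h | h⟩
    · left
      refine ⟨h1, ?_⟩
      rintro (⟨z, hz, h⟩ | ⟨z, hz, h⟩) <;> rcases h with ⟨rfl, rfl⟩ | ⟨rfl, rfl⟩ <;> tauto
    · right; left; exact ⟨y, h, by simp⟩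
    · right; right; exact ⟨y, h, by simp⟩
    · right; left; exact ⟨x, h, by simp⟩
    · right; right; exact ⟨x, h, by simp⟩

/-- The edges `uv` and `vw` removed. -/
abbrev cutGraph {V : Type*} (G : SimpleGraph V) (u v w : V) : SimpleGraph V :=
  G.deleteEdges {s(u, v), s(v, w)}

/-- The map identifying `v` and `w` with `u`. -/
def collapse {V : Type*} [DecidableEq V] (u v w x : V) : V := if x = v ∨ x = w then u else x

theorem sum_ite_collapse {V : Type*} [Fintype V] [DecidableEq V] {u v w : V} (huv : u ≠ v)
    (huw : u ≠ w) (hvw : v ≠ w) (y : V) (g : V → ℝ) :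
    ∑ x, (if collapse u v w x = y then g x else 0) =
      if y = u then g u + g v + g w else if y = v ∨ y = w then 0 else g y := by
  split_ifs with h1 h2
  · subst h1
    rw [← Finset.sum_subset (Finset.subset_univ {y, v, w})]
    · rw [Finset.sum_insert (by simp [huv, huw]), Finset.sum_insert (by simp [hvw]),
        Finset.sum_singleton]
      simp [collapse, add_assoc]
    · intro x _ hx
      simp only [Finset.mem_insert, Finset.mem_singleton, not_or] at hx
      simp [collapse, hx]
  · refine Finset.sum_eq_zero fun x _ => if_neg ?_
    unfold collapse
    split_ifs with h
    · tauto
    · rintro rfl; tauto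
  · rw [Finset.sum_eq_single y]
    · simp [collapse, h2]
    · intro x _ hx
      refine if_neg ?_
      unfold collapse
      split_ifs with h
      · tauto
      · exact hx
    · simp

theorem map_collapse_apply {V : Type*} [Fintype V] [DecidableEq V] {u v w : V} (huv : u ≠ v)
    (huw : u ≠ w) (hvw : v ≠ w) (A : Matrix V V ℝ) (y z : V) :
    (mapMatrix (collapse u v w) * A * (mapMatrix (collapse u v w))ᵀ) y z =
      if z = u then
        (if y = u then A u u + A v u + A w u else if y = v ∨ y = w then 0 else A y u) +
        (if y = u then A u v + A v v + A w v else if y = v ∨ y = w then 0 else A y v) +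
        (if y = u then A u w + A v w + A w w else if y = v ∨ y = w then 0 else A y w)
      else if z = v ∨ z = w then 0 else
        (if y = u then A u z + A v z + A w z else if y = v ∨ y = w then 0 else A y z) := by
  rw [Matrix.mul_apply]
  simp only [Matrix.transpose_apply, mapMatrix, Matrix.of_apply, mul_ite, mul_one, mul_zero]
  rw [sum_ite_collapse huv huw hvw]
  simp only [Matrix.mul_apply, Matrix.of_apply, ite_mul, one_mul, zero_mul,
    sum_ite_collapse huv huw hvw]

/-- The family `u, v, w`. -/
def triple {V : Type*} (u v w : V) : Fin 3 → V := ![u, v, w]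

@[simp] theorem triple_zero {V : Type*} (u v w : V) : triple u v w 0 = u := rfl

@[simp] theorem triple_one {V : Type*} (u v w : V) : triple u v w 1 = v := rfl

@[simp] theorem triple_two {V : Type*} (u v w : V) : triple u v w 2 = w := rfl

theorem map_triple_apply {V : Type*} [DecidableEq V] (u v w : V)
    (S : Matrix (Fin 3) (Fin 3) ℝ) (y z : V) :
    (mapMatrix (triple u v w) * S * (mapMatrix (triple u v w))ᵀ) y z =
      (if u = z then (if u = y then S 0 0 else 0) + (if v = y then S 1 0 else 0) +
        (if w = y then S 2 0 else 0) else 0) +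
      (if v = z then (if u = y then S 0 1 else 0) + (if v = y then S 1 1 else 0) +
        (if w = y then S 2 1 else 0) else 0) +
      (if w = z then (if u = y then S 0 2 else 0) + (if v = y then S 1 2 else 0) +
        (if w = y then S 2 2 else 0) else 0) := by
  simp [mapMatrix, Matrix.mul_apply, Fin.sum_univ_three]
  rfl

/-- The adjacency matrix of the path `0 - 1 - 2`. -/
def pathAdj : Matrix (Fin 3) (Fin 3) ℝ := !![0, 1, 0; 1, 0, 1; 0, 1, 0]

/-- The adjacency matrix of the path `1 - 0 - 2`. -/
def starAdj : Matrix (Fin 3) (Fin 3) ℝ := !![0, 1, 1; 1, 0, 0; 1, 0, 0]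

theorem realAdj_eq_cutGraph_add {V : Type*} [DecidableEq V] {G : SimpleGraph V} {u v w : V}
    (huv : G.Adj u v) (hvw : G.Adj v w) (huw : u ≠ w) :
    realAdj G = realAdj (cutGraph G u v w) + mapMatrix (triple u v w) * pathAdj *
      (mapMatrix (triple u v w))ᵀ := by
  classical
  ext x y
  rw [Matrix.add_apply, map_triple_apply]
  have h1 := huv.ne
  have h2 := hvw.ne
  have h3 := huv.symm
  have h4 := hvw.symm
  simp only [pathAdj, Matrix.of_apply, Matrix.cons_val]
  simp only [realAdj, Matrix.of_apply, SimpleGraph.deleteEdges_adj, Set.mem_insert_iff,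
    Set.mem_singleton_iff, Sym2.eq_iff]
  by_cases hxu : x = u
  · subst hxu; by_cases hy : y = v <;> simp_all [eq_comm]
  by_cases hxv : x = v
  · subst hxv; by_cases hy : y = u <;> by_cases hy : y = w <;> simp_all [eq_comm]
  by_cases hxw : x = w
  · subst hxw; by_cases hy : y = v <;> simp_all [eq_comm]
  simp [hxu, hxv, hxw, Ne.symm hxu, Ne.symm hxv, Ne.symm hxw]

/-- Once uv and vw are gone, the neighbourhoods of u, v, w are pairwise disjoint and none of the
three is adjacent to another. Merging them therefore creates neither loops nor multiple edges, and
the pushforward is again a 0-1 matrix. -/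
theorem realAdj_moveEdges {V : Type*} [Fintype V] [DecidableEq V] {G : SimpleGraph V} {u v w : V}
    (huv : G.Adj u v) (hvw : G.Adj v w) (huw : u ≠ w)
    (hNuv : G.neighborSet u ∩ G.neighborSet v = ∅)
    (hNvw : G.neighborSet v ∩ G.neighborSet w = ∅)
    (hNuw : G.neighborSet u ∩ G.neighborSet w = {v}) :
    realAdj (moveEdges G u v w) = mapMatrix (collapse u v w) * realAdj (cutGraph G u v w) *
        (mapMatrix (collapse u v w))ᵀ + mapMatrix (triple u v w) * starAdj *
      (mapMatrix (triple u v w))ᵀ := by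
  have h1 := huv.ne
  have h2 := hvw.ne
  have h3 := huv.symm
  have h4 := hvw.symm
  have n1 : ∀ z, G.Adj u z → ¬ G.Adj v z := fun z hz hz' => by
    have : z ∈ G.neighborSet u ∩ G.neighborSet v := ⟨hz, hz'⟩
    simp [hNuv] at this
  have n2 : ∀ z, G.Adj v z → ¬ G.Adj w z := fun z hz hz' => by
    have : z ∈ G.neighborSet v ∩ G.neighborSet w := ⟨hz, hz'⟩
    simp [hNvw] at this
  have n3 : ∀ z, G.Adj u z → G.Adj w z → z = v := fun z hz hz' => by
    have : z ∈ G.neighborSet u ∩ G.neighborSet w := ⟨hz, hz'⟩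
    simpa [hNuw] using this
  have huw' : ¬ G.Adj u w := fun h => n2 u h3 h.symm
  have hwu' : ¬ G.Adj w u := fun h => huw' h.symm
  classical
  ext y z
  rw [Matrix.add_apply, map_triple_apply, map_collapse_apply h1 huw h2]
  simp only [starAdj, Matrix.of_apply, Matrix.cons_val]
  simp only [realAdj, Matrix.of_apply, SimpleGraph.deleteEdges_adj, Set.mem_insert_iff,
    Set.mem_singleton_iff, Sym2.eq_iff, moveEdges_adj h1 huw h2]
  have s1 := G.adj_comm
  by_cases hyu : y = u
  · subst hyu
    by_cases hzu : z = y
    · subst hzu; simp_all [eq_comm]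
    by_cases hzv : z = v
    · subst hzv; simp_all [eq_comm]
    by_cases hzw : z = w
    · subst hzw; simp_all [eq_comm]
    have m1 := n1 z
    have m2 := n2 z
    have m3 := n3 z
    simp [h1, h2, huw, hzu, hzv, hzw, Ne.symm hzu, Ne.symm hzv, Ne.symm hzw, h1.symm, h2.symm,
      huw.symm]
    by_cases ha : G.Adj y z <;> by_cases hb : G.Adj v z <;> by_cases hc : G.Adj w z <;> simp_all
  by_cases hzu : z = u
  · subst hzu
    by_cases hyv : y = v
    · subst hyv; simp_all [eq_comm]
    by_cases hyw : y = w
    · subst hyw; simp_all [eq_comm]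
    have m1 := n1 y
    have m2 := n2 y
    have m3 := n3 y
    simp [h1, h2, huw, hyu, hyv, hyw, Ne.symm hyu, Ne.symm hyv, Ne.symm hyw, h1.symm, h2.symm,
      huw.symm, s1 y]
    by_cases ha : G.Adj z y <;> by_cases hb : G.Adj v y <;> by_cases hc : G.Adj w y <;> simp_all
  by_cases hyv : y = v
  · subst hyv; by_cases hzw : z = w <;> by_cases hzw : z = y <;> simp_all [eq_comm]
  by_cases hyw : y = w
  · subst hyw; by_cases hzw : z = v <;> by_cases hzw : z = y <;> simp_all [eq_comm]
  by_cases hzv : z = v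
  · subst hzv; simp_all [eq_comm]
  by_cases hzw : z = w
  · subst hzw; simp_all [eq_comm]
  simp [hyu, hyv, hyw, hzu, hzv, hzw, Ne.symm hzu, Ne.symm hzv, Ne.symm hzw]
  by_cases h : G.Adj y z
  · simp [h, h.ne]
  · simp [h]

/-! ### The 3×3 determinants of the path and the star -/

/-- The constant coefficient of the difference of the path and the star expansion. -/
def lowExcess (a b c d : ℝ) : ℝ :=
  (1 - d) * (1 - (a * b - c ^ 2)) + d * (1 - (a + b - 2 * c) + (a * b - c ^ 2))

/-- The linear coefficient of the difference of the path and the star expansion. -/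
def highExcess (a b c d : ℝ) : ℝ :=
  (a + b - 2 * (a * b - c ^ 2)) + 2 * d * (1 - (a + b - 2 * c) + (a * b - c ^ 2))

theorem signlessLaplacian_pathAdj :
    signlessLaplacian pathAdj = !![1, 1, 0; 1, 2, 1; 0, 1, 1] := by
  ext i j
  fin_cases i <;> fin_cases j <;>
    simp [signlessLaplacian, pathAdj, Fin.sum_univ_three]
  all_goals norm_num

theorem signlessLaplacian_starAdj :
    signlessLaplacian starAdj = !![2, 1, 1; 1, 1, 0; 1, 0, 1] := by
  ext i j
  fin_cases i <;> fin_cases j <;>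
    simp [signlessLaplacian, starAdj, Fin.sum_univ_three]
  all_goals norm_num

theorem one_eq_fin_three : (1 : Matrix (Fin 3) (Fin 3) ℝ) = !![1, 0, 0; 0, 1, 0; 0, 0, 1] := by
  ext i j
  fin_cases i <;> fin_cases j <;> simp

theorem det_path_expansion (a b c d t : ℝ) (Y : Matrix (Fin 3) (Fin 3) ℝ)
    (hY : (1 + t • signlessLaplacian pathAdj) * (1 + Y) = 1) :
    det (1 + t • signlessLaplacian pathAdj) *
        det (1 + Y * (1 - !![a, 0, c; 0, d, 0; c, 0, b])) =
      1 + t * (a + b + 2 * d) + t ^ 2 * ((a * b - c ^ 2) + d * (a + b - 2 * c)) := by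
  rw [← Matrix.det_mul]
  set S := t • signlessLaplacian pathAdj with hS
  set M : Matrix (Fin 3) (Fin 3) ℝ := !![a, 0, c; 0, d, 0; c, 0, b] with hM
  -- The relation (1 + S)Y = -S removes Y, so no explicit inverse is needed for the path.
  have h1 : (1 + S) * (1 + Y * (1 - M)) = 1 + S * M := by
    have : (1 + S) * Y = -S := by
      have : (1 + S) * Y = (1 + S) * (1 + Y) - (1 + S) := by noncomm_ring
      rw [this, hY]; abel
    rw [Matrix.mul_add, ← Matrix.mul_assoc, this]
    noncomm_ring
  rw [h1, hS, signlessLaplacian_pathAdj, hM, one_eq_fin_three]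
  simp only [Matrix.det_fin_three, Matrix.add_apply, Matrix.mul_apply, Matrix.smul_apply,
    Fin.sum_univ_three, Matrix.of_apply, Matrix.cons_val, smul_eq_mul]
  ring

theorem det_star_expansion (a b c d t : ℝ) (ht : 0 < t) :
    det (1 + t • signlessLaplacian starAdj) *
        det (1 + (((1 + t) / (1 + 3 * t)) • (Matrix.of fun _ _ => 1) - 1) *
          (1 - !![a, 0, c; 0, d, 0; c, 0, b])) =
      (1 + t) ^ 2 * ((a + b - 2 * c) * d + (a * b - c ^ 2)) -
        2 * (1 + t) * (a * b - c ^ 2) * d := by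
  have h3 : 1 + 3 * t ≠ 0 := by positivity
  obtain ⟨κ, hκ⟩ : ∃ κ, κ = (1 + t) / (1 + 3 * t) := ⟨_, rfl⟩
  have hκ' : κ * (1 + 3 * t) = 1 + t := by rw [hκ]; field_simp
  rw [← hκ]
  have hd : det (1 + t • signlessLaplacian starAdj) = (1 + t) * (1 + 3 * t) := by
    rw [signlessLaplacian_starAdj, one_eq_fin_three]
    simp [Matrix.det_fin_three, -smul_of, -smul_cons]
    ring
  -- With M the projection block and J the all-ones matrix, the argument is M + κJ(1 - M). This is a
  -- rank-one update of M, so its determinant is linear in κ.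
  have hz : det (1 + (κ • (Matrix.of fun _ _ => 1) - 1) * (1 - !![a, 0, c; 0, d, 0; c, 0, b])) =
      κ * ((a + b - 2 * c) * d + (a * b - c ^ 2)) +
        (1 - 3 * κ) * (a * b - c ^ 2) * d := by
    rw [one_eq_fin_three]
    simp only [Matrix.det_fin_three, Matrix.add_apply, Matrix.sub_apply, Matrix.mul_apply,
      Matrix.smul_apply, Fin.sum_univ_three, Matrix.of_apply, Matrix.cons_val, smul_eq_mul]
    ring
  rw [hd, hz]
  linear_combination ((1 + t) * ((a + b - 2 * c) * d + (a * b - c ^ 2)) -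
    3 * (1 + t) * (a * b - c ^ 2) * d) * hκ'

theorem star_inverse (t : ℝ) (ht : 0 < t) :
    ∃ Y : Matrix (Fin 3) (Fin 3) ℝ, (1 + t • signlessLaplacian starAdj) * (1 + Y) = 1 ∧
      1 + Y 0 0 = (1 + t) / (1 + 3 * t) := by
  have h1 : 1 + t ≠ 0 := by positivity
  have h3 : 1 + 3 * t ≠ 0 := by positivity
  refine ⟨(1 / ((1 + t) * (1 + 3 * t))) • !![(1 + t) ^ 2, -(t * (1 + t)), -(t * (1 + t));
    -(t * (1 + t)), 1 + 3 * t + t ^ 2, t ^ 2; -(t * (1 + t)), t ^ 2, 1 + 3 * t + t ^ 2] - 1,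
    ?_, ?_⟩
  · rw [add_sub_cancel, signlessLaplacian_starAdj, one_eq_fin_three]
    ext i j
    fin_cases i <;> fin_cases j <;>
      simp [Matrix.mul_apply, Fin.sum_univ_three, -smul_of, -smul_cons] <;> field_simp <;> ring
  · simp
    field_simp

theorem path_inverse (t : ℝ) (ht : 0 < t) :
    ∃ Y : Matrix (Fin 3) (Fin 3) ℝ, (1 + t • signlessLaplacian pathAdj) * (1 + Y) = 1 := by
  refine ⟨(1 + t • signlessLaplacian pathAdj)⁻¹ - 1, ?_⟩
  rw [add_sub_cancel, Matrix.mul_nonsing_inv]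
  have : det (1 + t • signlessLaplacian pathAdj) = (1 + t) * (1 + 3 * t) := by
    rw [signlessLaplacian_pathAdj, one_eq_fin_three]
    simp [Matrix.det_fin_three, -smul_of, -smul_cons]
    ring
  rw [this]
  exact isUnit_iff_ne_zero.2 (by positivity)

/-- All three vertices are sent to u, so the pulled-back form has the constant entry 1 + Y₀₀ on
their block. Only this one entry of the inverse is ever needed. -/
theorem collapse_conj {V : Type*} [Fintype V] [DecidableEq V] {u v w : V} (huv : u ≠ v)
    (huw : u ≠ w) (hvw : v ≠ w) (Y : Matrix (Fin 3) (Fin 3) ℝ) :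
    (mapMatrix (collapse u v w))ᵀ *
        (1 + mapMatrix (triple u v w) * Y * (mapMatrix (triple u v w))ᵀ) *
        mapMatrix (collapse u v w) =
      1 + mapMatrix (triple u v w) * ((1 + Y 0 0) • (Matrix.of fun _ _ => 1) - 1 : Matrix (Fin 3) (Fin 3) ℝ) *
        (mapMatrix (triple u v w))ᵀ := by
  rw [mapMatrix_transpose_mul, mul_mapMatrix, Matrix.submatrix_submatrix]
  ext x y
  have h1 := huv.symm
  have h2 := huw.symm
  have h3 := hvw.symm
  simp only [Matrix.submatrix_apply, Matrix.add_apply, map_triple_apply, Function.comp,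
    id, Matrix.sub_apply, Matrix.smul_apply, Matrix.of_apply, Matrix.one_apply, collapse]
  have key : ∀ z, z = u ∨ z = v ∨ z = w ∨ (z ≠ u ∧ z ≠ v ∧ z ≠ w ∧ u ≠ z ∧ v ≠ z ∧ w ≠ z) := by
    intro z; grind
  rcases key x with rfl | rfl | rfl | ⟨hx1, hx2, hx3, hx4, hx5, hx6⟩ <;>
    rcases key y with rfl | rfl | rfl | ⟨hy1, hy2, hy3, hy4, hy5, hy6⟩ <;>
    simp [*]

/-! ### The coefficient difference as a weighted sum over edge sets -/

/-- The Gram determinant of a set of edges. -/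
noncomputable def edgeGram {V : Type*} [Fintype V] [DecidableEq V] (G : SimpleGraph V)
    (F : Finset (Sym2 V)) : ℝ :=
  ((columns (realInc G) F)ᵀ * columns (realInc G) F).det

/-- The projection to the orthogonal complement of the incidence vectors of a set of edges. -/
noncomputable def edgeProj {V : Type*} [Fintype V] [DecidableEq V] (G : SimpleGraph V)
    (F : Finset (Sym2 V)) : Matrix V V ℝ :=
  complProj (columns (realInc G) F)

theorem edgeProj_submatrix {V : Type*} [Fintype V] [DecidableEq V] {G : SimpleGraph V}
    {F : Finset (Sym2 V)} {u v w : V} (h1 : edgeProj G F v u = 0) (h2 : edgeProj G F v w = 0) :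
    (edgeProj G F).submatrix (triple u v w) (triple u v w) =
      !![edgeProj G F u u, 0, edgeProj G F u w; 0, edgeProj G F v v, 0;
        edgeProj G F u w, 0, edgeProj G F w w] := by
  have h3 : edgeProj G F u v = 0 := (complProj_comm _ _ _).trans h1
  have h4 : edgeProj G F w v = 0 := (complProj_comm _ _ _).trans h2
  have h5 : edgeProj G F w u = edgeProj G F u w := complProj_comm _ _ _
  ext i j
  fin_cases i <;> fin_cases j <;> simp [h1, h2, h3, h4, h5]

section difference

variable {V : Type*} [Fintype V] [DecidableEq V] {G : SimpleGraph V} {u v w : V}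

theorem triple_injective {V : Type*} {u v w : V} (h1 : u ≠ v) (h2 : u ≠ w) (h3 : v ≠ w) :
    Function.Injective (triple u v w) := by
  intro i j hij
  fin_cases i <;> fin_cases j <;> simp_all [eq_comm]

/-- The path and star expansions have the same t² coefficient (ab - c²) + d(a + b - 2c), so each
edge set reaches only the powers |F| and |F| + 1 of t. -/
theorem det_sub_det_moveEdges (huv : G.Adj u v) (hvw : G.Adj v w) (huw : u ≠ w)
    (hNuv : G.neighborSet u ∩ G.neighborSet v = ∅)
    (hNvw : G.neighborSet v ∩ G.neighborSet w = ∅)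
    (hNuw : G.neighborSet u ∩ G.neighborSet w = {v})
    (hcut : ∀ F, edgeGram (cutGraph G u v w) F ≠ 0 →
      edgeProj (cutGraph G u v w) F v u = 0 ∧ edgeProj (cutGraph G u v w) F v w = 0)
    (t : ℝ) (ht : 0 < t) :
    det (1 + t • signlessLaplacian (realAdj G)) -
        det (1 + t • signlessLaplacian (realAdj (moveEdges G u v w))) =
      ∑ F, edgeGram (cutGraph G u v w) F * (t ^ F.card *
        (lowExcess (edgeProj (cutGraph G u v w) F u u) (edgeProj (cutGraph G u v w) F w w)
            (edgeProj (cutGraph G u v w) F u w) (edgeProj (cutGraph G u v w) F v v) +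
          t * highExcess (edgeProj (cutGraph G u v w) F u u) (edgeProj (cutGraph G u v w) F w w)
            (edgeProj (cutGraph G u v w) F u w) (edgeProj (cutGraph G u v w) F v v))) := by
  have he : Function.Injective (triple u v w) := triple_injective huv.ne huw hvw.ne
  obtain ⟨Y, hY⟩ := path_inverse t ht
  obtain ⟨Y', hY', hκ⟩ := star_inverse t ht
  have e1 : 1 + t • signlessLaplacian (realAdj G) =
      1 + t • (1 * (realInc (cutGraph G u v w) * (realInc (cutGraph G u v w))ᵀ) *
        (1 : Matrix V V ℝ)ᵀ) + mapMatrix (triple u v w) * (t • signlessLaplacian pathAdj) *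
          (mapMatrix (triple u v w))ᵀ := by
    rw [realAdj_eq_cutGraph_add huv hvw huw, signlessLaplacian_add, signlessLaplacian_map,
      realInc_mul_transpose, Matrix.transpose_one, Matrix.one_mul, Matrix.mul_one, smul_add,
      Matrix.mul_smul, Matrix.smul_mul, add_assoc]
  have e2 : 1 + t • signlessLaplacian (realAdj (moveEdges G u v w)) =
      1 + t • (mapMatrix (collapse u v w) *
          (realInc (cutGraph G u v w) * (realInc (cutGraph G u v w))ᵀ) *
        (mapMatrix (collapse u v w))ᵀ) +
        mapMatrix (triple u v w) * (t • signlessLaplacian starAdj) *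
          (mapMatrix (triple u v w))ᵀ := by
    rw [realAdj_moveEdges huv hvw huw hNuv hNvw hNuw, signlessLaplacian_add,
      signlessLaplacian_map, signlessLaplacian_map, realInc_mul_transpose, smul_add,
      Matrix.mul_smul, Matrix.smul_mul, add_assoc]
  rw [e1, e2, det_one_add_map_eq_sum _ _ he 1 _ Y Y hY (by simp) t,
    det_one_add_map_eq_sum _ _ he _ _ Y' _ hY' (collapse_conj huv.ne huw hvw.ne Y') t,
    ← Finset.sum_sub_distrib]
  refine Finset.sum_congr rfl fun F _ => ?_
  change t ^ F.card * (edgeGram _ F * (_ * det (1 + Y * (1 - (edgeProj _ F).submatrix _ _)))) -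
    t ^ F.card * (edgeGram _ F * (_ * det (1 + _ * (1 - (edgeProj _ F).submatrix _ _)))) = _
  by_cases hF : edgeGram (cutGraph G u v w) F = 0
  · rw [hF]; ring
  obtain ⟨h1, h2⟩ := hcut F hF
  rw [edgeProj_submatrix h1 h2, det_path_expansion _ _ _ _ t Y hY, hκ,
    det_star_expansion _ _ _ _ t ht, lowExcess, highExcess]
  ring

/-- The difference of the coefficients as a sum over sets of edges. -/
theorem signlessLaplacianCoeff_sub (huv : G.Adj u v) (hvw : G.Adj v w) (huw : u ≠ w)
    (hNuv : G.neighborSet u ∩ G.neighborSet v = ∅)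
    (hNvw : G.neighborSet v ∩ G.neighborSet w = ∅)
    (hNuw : G.neighborSet u ∩ G.neighborSet w = {v})
    (hcut : ∀ F, edgeGram (cutGraph G u v w) F ≠ 0 →
      edgeProj (cutGraph G u v w) F v u = 0 ∧ edgeProj (cutGraph G u v w) F v w = 0)
    {k : ℕ} (hk : k ≤ Fintype.card V) :
    (signlessLaplacianCoeff G k : ℝ) - signlessLaplacianCoeff (moveEdges G u v w) k =
      ∑ F, edgeGram (cutGraph G u v w) F *
        ((if k = F.card then
          lowExcess (edgeProj (cutGraph G u v w) F u u) (edgeProj (cutGraph G u v w) F w w)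
            (edgeProj (cutGraph G u v w) F u w) (edgeProj (cutGraph G u v w) F v v) else 0) +
          if k = F.card + 1 then
            highExcess (edgeProj (cutGraph G u v w) F u u) (edgeProj (cutGraph G u v w) F w w)
            (edgeProj (cutGraph G u v w) F u w) (edgeProj (cutGraph G u v w) F v v) else 0) := by
  set H := cutGraph G u v w with hH
  have hpoly : det (1 + (X : ℝ[X]) • (signlessLaplacian (realAdj G)).map C) -
      det (1 + (X : ℝ[X]) • (signlessLaplacian (realAdj (moveEdges G u v w))).map C) =
      ∑ F, C (edgeGram H F) * (C (lowExcess (edgeProj H F u u) (edgeProj H F w w)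
        (edgeProj H F u w) (edgeProj H F v v)) * X ^ F.card +
        C (highExcess (edgeProj H F u u) (edgeProj H F w w)
        (edgeProj H F u w) (edgeProj H F v v)) * X ^ (F.card + 1)) := by
    -- The inverses were built for t > 0 only, which is enough for an identity of polynomials.
    refine Polynomial.eq_of_infinite_eval_eq _ _ ((Set.Ioi_infinite (0 : ℝ)).mono fun t ht => ?_)
    have h := det_sub_det_moveEdges huv hvw huw hNuv hNvw hNuw hcut t ht
    rw [Set.mem_ofPred_eq, Polynomial.eval_sub, Matrix.eval_det_one_add_X_smul,
      Matrix.eval_det_one_add_X_smul, h, Polynomial.eval_finsetSum]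
    refine Finset.sum_congr rfl fun F _ => ?_
    simp only [eval_mul, eval_C, eval_add, eval_pow, eval_X]
    ring
  rw [signlessLaplacianCoeff_eq_coeff _ hk, signlessLaplacianCoeff_eq_coeff _ hk,
    ← Polynomial.coeff_sub, hpoly, Polynomial.finsetSum_coeff]
  refine Finset.sum_congr rfl fun F _ => ?_
  rw [Polynomial.coeff_C_mul, Polynomial.coeff_add, Polynomial.coeff_C_mul_X_pow,
    Polynomial.coeff_C_mul_X_pow]

end difference

/-! ### Entries of the projection and signs of the excesses -/

section edgeProj

variable {V : Type*} [Fintype V] [DecidableEq V] {H : SimpleGraph V} {F : Finset (Sym2 V)}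

theorem realInc_apply {V : Type*} [DecidableEq V] {H : SimpleGraph V} {a b : V}
    (h : H.Adj a b) (x : V) :
    realInc H x s(a, b) = (if x = a then 1 else 0) + (if x = b then 1 else 0) := by
  classical
  have hne := h.ne
  rw [realInc, SimpleGraph.incMatrix_apply']
  simp only [SimpleGraph.mk'_mem_incidenceSet_iff, h, true_and]
  by_cases hxa : x = a <;> by_cases hxb : x = b <;> simp_all

theorem realInc_of_not_mem {V : Type*} [DecidableEq V] {H : SimpleGraph V} {e : Sym2 V}
    (h : e ∉ H.edgeSet) (x : V) : realInc H x e = 0 := by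
  classical
  rw [realInc, SimpleGraph.incMatrix_apply']
  exact if_neg fun h' => h h'.1

/-- The complement of the column space consists of the functions alternating along F; this is how
the geometry of F controls the projection. -/
theorem columns_transpose_mulVec_eq_zero_iff (hF : ∀ e ∈ F, e ∈ H.edgeSet) (y : V → ℝ) :
    (columns (realInc H) F)ᵀ *ᵥ y = 0 ↔ ∀ a b, s(a, b) ∈ F → y a + y b = 0 := by
  have key : ∀ a b (h : s(a, b) ∈ F), ((columns (realInc H) F)ᵀ *ᵥ y) ⟨s(a, b), h⟩ = y a + y b := by
    intro a b h
    simp only [Matrix.mulVec, dotProduct, Matrix.transpose_apply, columns,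
      Matrix.submatrix_apply, id, realInc_apply ((SimpleGraph.mem_edgeSet H).1 (hF _ h)), add_mul,
      ite_mul, one_mul, zero_mul, Finset.sum_add_distrib, Finset.sum_ite_eq', Finset.mem_univ,
      if_true]
  constructor
  · intro h a b hab
    rw [← key a b hab, h]
    rfl
  · intro h
    ext ⟨e, he⟩
    induction e with
    | h a b => rw [key a b he, h a b he]; rfl

theorem edgeGram_nonneg (H : SimpleGraph V) (F : Finset (Sym2 V)) : 0 ≤ edgeGram H F := by
  have := (Matrix.posSemidef_conjTranspose_mul_self (columns (realInc H) F)).det_nonneg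
  rwa [Matrix.conjTranspose_eq_transpose_of_trivial] at this

theorem mem_edgeSet_of_edgeGram_ne_zero (hF : edgeGram H F ≠ 0) {e : Sym2 V} (he : e ∈ F) :
    e ∈ H.edgeSet := by
  by_contra h
  refine hF (Matrix.det_eq_zero_of_row_eq_zero ⟨e, he⟩ fun j => ?_)
  rw [Matrix.mul_apply]
  exact Finset.sum_eq_zero fun x _ => by
    rw [Matrix.transpose_apply, columns, Matrix.submatrix_apply, realInc_of_not_mem h, zero_mul]

theorem edgeProj_add_eq_zero (hF : edgeGram H F ≠ 0) {a b : V} (hab : s(a, b) ∈ F) (x : V) :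
    edgeProj H F a x + edgeProj H F b x = 0 := by
  refine (columns_transpose_mulVec_eq_zero_iff
    (fun e he => mem_edgeSet_of_edgeGram_ne_zero hF he) (fun z => edgeProj H F z x)).1 ?_ a b hab
  exact funext fun e => congrFun (congrFun (transpose_mul_complProj hF) e) x

theorem edgeProj_mulVec (hF : edgeGram H F ≠ 0) {y : V → ℝ}
    (hy : ∀ a b, s(a, b) ∈ F → y a + y b = 0) : edgeProj H F *ᵥ y = y :=
  complProj_mulVec ((columns_transpose_mulVec_eq_zero_iff
    (fun e he => mem_edgeSet_of_edgeGram_ne_zero hF he) y).2 hy)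

/-- The projection is block diagonal for every set of vertices that is closed under the edges. -/
theorem edgeProj_eq_zero (hF : edgeGram H F ≠ 0) {K : Set V}
    (hK : ∀ a b, s(a, b) ∈ F → (a ∈ K ↔ b ∈ K)) {x u : V} (hx : x ∈ K) (hu : u ∉ K) :
    edgeProj H F x u = 0 := by
  classical
  -- The column of u cut off to K is still alternating along F, hence fixed by the projection. Its
  -- squared norm is then its value at u, which is 0.
  set z : V → ℝ := fun a => if a ∈ K then edgeProj H F a u else 0 with hz
  have h1 : edgeProj H F *ᵥ z = z := by
    refine edgeProj_mulVec hF fun a b hab => ?_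
    have := edgeProj_add_eq_zero hF hab u
    have h2 := hK a b hab
    by_cases ha : a ∈ K
    · simp [hz, ha, h2.1 ha, this]
    · have hb : b ∉ K := fun hb => ha (h2.2 hb)
      simp [hz, ha, hb]
  have h2 : ∑ a, z a ^ 2 = 0 := by
    have h3 : (edgeProj H F *ᵥ z) u = 0 := by rw [h1]; simp [hz, hu]
    rw [← h3]
    refine Finset.sum_congr rfl fun a _ => ?_
    change z a ^ 2 = edgeProj H F u a * z a
    rw [show edgeProj H F u a = edgeProj H F a u from complProj_comm _ _ _]
    by_cases ha : a ∈ K <;> simp [hz, ha, sq]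
  have h4 := (Finset.sum_eq_zero_iff_of_nonneg fun a _ => sq_nonneg (z a)).1 h2 x
    (Finset.mem_univ x)
  simpa [hz, hx] using h4

/-- Entries of a column change sign along each edge of F, so their absolute value is constant on
components. -/
theorem edgeProj_sq_eq (hF : edgeGram H F ≠ 0) (x : V) {a b : V}
    (hab : (SimpleGraph.fromEdgeSet (F : Set (Sym2 V))).Reachable a b) :
    edgeProj H F a x ^ 2 = edgeProj H F b x ^ 2 := by
  obtain ⟨p⟩ := hab
  induction p with
  | nil => rfl
  | cons h p ih =>
    rw [← ih]
    have := edgeProj_add_eq_zero hF ((SimpleGraph.fromEdgeSet_adj _).1 h).1 x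
    rw [eq_neg_of_add_eq_zero_left this, neg_sq]

theorem edgeProj_eq_zero_of_not_reachable (hF : edgeGram H F ≠ 0) {u w : V}
    (h : ¬ (SimpleGraph.fromEdgeSet (F : Set (Sym2 V))).Reachable u w) :
    edgeProj H F u w = 0 := by
  refine edgeProj_eq_zero hF
    (K := {x | (SimpleGraph.fromEdgeSet (F : Set (Sym2 V))).Reachable u x}) ?_
    (SimpleGraph.Reachable.refl u) h
  intro a b hab
  by_cases hne : a = b
  · rw [hne]
  have hadj : (SimpleGraph.fromEdgeSet (F : Set (Sym2 V))).Adj a b :=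
    (SimpleGraph.fromEdgeSet_adj _).2 ⟨hab, hne⟩
  exact ⟨fun h => h.trans hadj.reachable, fun h => h.trans hadj.symm.reachable⟩

theorem SimpleGraph.Reachable.exists_adj {V : Type*} {G : SimpleGraph V} {a b : V}
    (h : G.Reachable a b) (hne : a ≠ b) : ∃ x, G.Adj a x := by
  obtain ⟨p⟩ := h
  cases p with
  | nil => exact absurd rfl hne
  | cons h _ => exact ⟨_, h⟩

/-- If two vertices at distance at least three are negatively correlated, then their component has
at least four vertices. -/
theorem edgeProj_of_neg (hF : edgeGram H F ≠ 0) {u w : V} (huw : u ≠ w) (hadj : ¬ H.Adj u w)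
    (hcommon : ∀ x, H.Adj u x → ¬ H.Adj w x) (hneg : edgeProj H F u w < 0) :
    edgeProj H F u u = -edgeProj H F u w ∧ edgeProj H F w w = -edgeProj H F u w ∧
      -edgeProj H F u w ≤ 1 / 4 := by
  have hr : (SimpleGraph.fromEdgeSet (F : Set (Sym2 V))).Reachable u w := by
    by_contra h
    exact hneg.ne (edgeProj_eq_zero_of_not_reachable hF h)
  have hc : edgeProj H F w u = edgeProj H F u w := complProj_comm _ _ _
  have hsq := edgeProj_sq_eq hF u hr
  have hsq' := edgeProj_sq_eq hF w hr
  have hu : 0 ≤ edgeProj H F u u := complProj_diag_nonneg hF u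
  have hw : 0 ≤ edgeProj H F w w := complProj_diag_nonneg hF w
  have h1 : edgeProj H F u u = -edgeProj H F u w := by
    rw [hc] at hsq
    rcases sq_eq_sq_iff_eq_or_eq_neg.1 hsq with h | h <;> linarith
  have h2 : edgeProj H F w w = -edgeProj H F u w := by
    rcases sq_eq_sq_iff_eq_or_eq_neg.1 hsq' with h | h <;> linarith
  refine ⟨h1, h2, ?_⟩
  obtain ⟨x, hx⟩ := hr.exists_adj huw
  obtain ⟨z, hz⟩ := hr.symm.exists_adj huw.symm
  have hxF := ((SimpleGraph.fromEdgeSet_adj _).1 hx).1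
  have hzF := ((SimpleGraph.fromEdgeSet_adj _).1 hz).1
  have hxH : H.Adj u x := (SimpleGraph.mem_edgeSet H).1 (mem_edgeSet_of_edgeGram_ne_zero hF hxF)
  have hzH : H.Adj w z := (SimpleGraph.mem_edgeSet H).1 (mem_edgeSet_of_edgeGram_ne_zero hF hzF)
  have hxw : x ≠ w := by rintro rfl; exact hadj hxH
  have hzu : z ≠ u := by rintro rfl; exact hadj hzH.symm
  have hxz : x ≠ z := by rintro rfl; exact hcommon _ hxH hzH
  have ex := edgeProj_add_eq_zero hF hxF u
  have ez := edgeProj_add_eq_zero hF hzF u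
  -- The four entries all have absolute value -c, where c = Π_uw, so 4c² ≤ Π_uu = -c; this is the
  -- origin of the bound 1/4.
  have hsum : ∑ y ∈ ({u, w, x, z} : Finset V), edgeProj H F y u ^ 2 ≤ edgeProj H F u u := by
    rw [show edgeProj H F u u = ∑ y, edgeProj H F u y ^ 2 from complProj_diag hF u]
    simp_rw [fun y => show edgeProj H F y u = edgeProj H F u y from complProj_comm _ _ _]
    exact Finset.sum_le_sum_of_subset_of_nonneg (Finset.subset_univ _) fun _ _ _ => sq_nonneg _
  rw [Finset.sum_insert (by simp [huw, hxH.ne, hzu.symm]),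
    Finset.sum_insert (by simp [hxw.symm, hzH.ne]), Finset.sum_insert (by simp [hxz]),
    Finset.sum_singleton, hc] at hsum
  have e1 : edgeProj H F x u = edgeProj H F u w := by linarith
  have e2 : edgeProj H F z u = -edgeProj H F u w := by rw [hc] at ez; linarith
  rw [e1, e2, h1] at hsum
  nlinarith

/-- If c ≥ 0 the expression is (1 - a)(1 - b) + c(2 - c). If c < 0 then a = b = -c, and it becomes 1
+ 4c, which is nonnegative exactly because the component has at least four vertices. -/
theorem edgeProj_inner_nonneg (hF : edgeGram H F ≠ 0) {u w : V} (huw : u ≠ w)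
    (hadj : ¬ H.Adj u w) (hcommon : ∀ x, H.Adj u x → ¬ H.Adj w x) :
    0 ≤ 1 - (edgeProj H F u u + edgeProj H F w w - 2 * edgeProj H F u w) +
      (edgeProj H F u u * edgeProj H F w w - edgeProj H F u w ^ 2) := by
  rcases lt_or_ge (edgeProj H F u w) 0 with hneg | hpos
  · obtain ⟨h1, h2, h3⟩ := edgeProj_of_neg hF huw hadj hcommon hneg
    rw [h1, h2]
    nlinarith
  · have hu0 : 0 ≤ edgeProj H F u u := complProj_diag_nonneg hF u
    have hw0 : 0 ≤ edgeProj H F w w := complProj_diag_nonneg hF w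
    have hu : edgeProj H F u u ≤ 1 := complProj_diag_le_one hF u
    have hw : edgeProj H F w w ≤ 1 := complProj_diag_le_one hF w
    have hcu : edgeProj H F u w ^ 2 ≤ edgeProj H F u u := sq_le_complProj_diag hF u w
    have hcw : edgeProj H F u w ^ 2 ≤ 1 := hcu.trans hu
    have hc1 : edgeProj H F u w ≤ 1 := by nlinarith
    nlinarith [mul_nonneg (sub_nonneg.2 hu) (sub_nonneg.2 hw)]

theorem lowExcess_nonneg (hF : edgeGram H F ≠ 0) {u v w : V} (huw : u ≠ w)
    (hadj : ¬ H.Adj u w) (hcommon : ∀ x, H.Adj u x → ¬ H.Adj w x) :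
    0 ≤ lowExcess (edgeProj H F u u) (edgeProj H F w w) (edgeProj H F u w)
      (edgeProj H F v v) := by
  have hu0 : 0 ≤ edgeProj H F u u := complProj_diag_nonneg hF u
  have hw0 : 0 ≤ edgeProj H F w w := complProj_diag_nonneg hF w
  have hu : edgeProj H F u u ≤ 1 := complProj_diag_le_one hF u
  have hw : edgeProj H F w w ≤ 1 := complProj_diag_le_one hF w
  have hv0 : 0 ≤ edgeProj H F v v := complProj_diag_nonneg hF v
  have hv : edgeProj H F v v ≤ 1 := complProj_diag_le_one hF v
  refine add_nonneg (mul_nonneg (sub_nonneg.2 hv) ?_)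
    (mul_nonneg hv0 (edgeProj_inner_nonneg hF huw hadj hcommon))
  nlinarith [sq_nonneg (edgeProj H F u w), mul_le_one₀ hu hw0 hw]

/-- The discarded terms are 2c² and 2d times the quantity of `edgeProj_inner_nonneg`. The remaining
bound makes strict positivity easy to read off. -/
theorem le_highExcess (hF : edgeGram H F ≠ 0) {u v w : V} (huw : u ≠ w)
    (hadj : ¬ H.Adj u w) (hcommon : ∀ x, H.Adj u x → ¬ H.Adj w x) :
    edgeProj H F u u * (1 - edgeProj H F w w) + edgeProj H F w w * (1 - edgeProj H F u u) ≤
      highExcess (edgeProj H F u u) (edgeProj H F w w) (edgeProj H F u w)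
        (edgeProj H F v v) := by
  have hv0 : 0 ≤ edgeProj H F v v := complProj_diag_nonneg hF v
  have := mul_nonneg hv0 (edgeProj_inner_nonneg hF huw hadj hcommon)
  rw [highExcess]
  nlinarith [sq_nonneg (edgeProj H F u w)]

theorem highExcess_nonneg (hF : edgeGram H F ≠ 0) {u v w : V} (huw : u ≠ w)
    (hadj : ¬ H.Adj u w) (hcommon : ∀ x, H.Adj u x → ¬ H.Adj w x) :
    0 ≤ highExcess (edgeProj H F u u) (edgeProj H F w w) (edgeProj H F u w)
      (edgeProj H F v v) := by
  have hu0 : 0 ≤ edgeProj H F u u := complProj_diag_nonneg hF u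
  have hw0 : 0 ≤ edgeProj H F w w := complProj_diag_nonneg hF w
  have hu : edgeProj H F u u ≤ 1 := complProj_diag_le_one hF u
  have hw : edgeProj H F w w ≤ 1 := complProj_diag_le_one hF w
  refine le_trans ?_ (le_highExcess hF huw hadj hcommon)
  exact add_nonneg (mul_nonneg hu0 (sub_nonneg.2 hw)) (mul_nonneg hw0 (sub_nonneg.2 hu))

theorem highExcess_pos (hF : edgeGram H F ≠ 0) {u v w : V} (huw : u ≠ w)
    (hadj : ¬ H.Adj u w) (hcommon : ∀ x, H.Adj u x → ¬ H.Adj w x)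
    (h0 : edgeProj H F u u ≠ 0) (h1 : edgeProj H F u u < 1) :
    0 < highExcess (edgeProj H F u u) (edgeProj H F w w) (edgeProj H F u w)
      (edgeProj H F v v) := by
  have hu0 : 0 < edgeProj H F u u := (complProj_diag_nonneg hF u).lt_of_ne' h0
  have hw0 : 0 ≤ edgeProj H F w w := complProj_diag_nonneg hF w
  have hw : edgeProj H F w w ≤ 1 := complProj_diag_le_one hF w
  refine lt_of_lt_of_le ?_ (le_highExcess hF huw hadj hcommon)
  rcases hw.lt_or_eq with hw' | hw'
  · exact add_pos_of_pos_of_nonneg (mul_pos hu0 (sub_pos.2 hw')) (mul_nonneg hw0 (by linarith))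
  · rw [hw']
    linarith

/-- Positivity of the excess when the projection has rank one. -/
theorem highExcess_pos_of_trace (hF : edgeGram H F ≠ 0) {u v w : V} (huv : u ≠ v) (huw : u ≠ w)
    (hvw : v ≠ w) (hadj : ¬ H.Adj u w) (hcommon : ∀ x, H.Adj u x → ¬ H.Adj w x)
    (htr : (edgeProj H F).trace = 1) (h0 : edgeProj H F u u ≠ 0 ∨ edgeProj H F v v ≠ 0) :
    0 < highExcess (edgeProj H F u u) (edgeProj H F w w) (edgeProj H F u w)
      (edgeProj H F v v) := by
  have hu0 : 0 ≤ edgeProj H F u u := complProj_diag_nonneg hF u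
  have hw0 : 0 ≤ edgeProj H F w w := complProj_diag_nonneg hF w
  have hv0 : 0 ≤ edgeProj H F v v := complProj_diag_nonneg hF v
  have hsum : edgeProj H F u u + (edgeProj H F v v + edgeProj H F w w) ≤ 1 := by
    have : ∑ y ∈ ({u, v, w} : Finset V), edgeProj H F y y ≤ (edgeProj H F).trace :=
      Finset.sum_le_sum_of_subset_of_nonneg (Finset.subset_univ _)
        fun y _ _ => complProj_diag_nonneg hF y
    rwa [Finset.sum_insert (by simp [huv, huw]), Finset.sum_insert (by simp [hvw]),
      Finset.sum_singleton, htr] at this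
  have hle := le_highExcess (v := v) hF huw hadj hcommon
  -- If a = 0 then c = 0 and the excess is b + 2d(1 - b), with d > 0 and 1 - b ≥ d. If a > 0, then
  -- a(1 - b) ≥ a² is already positive.
  rcases eq_or_lt_of_le hu0 with hu | hu
  · have hv : 0 < edgeProj H F v v := hv0.lt_of_ne' (by
      rcases h0 with h | h
      · exact absurd hu.symm h
      · exact h)
    have hc : edgeProj H F u w = 0 := by
      have h1 : edgeProj H F u w ^ 2 ≤ edgeProj H F u u := sq_le_complProj_diag hF u w
      rw [← hu] at h1
      exact pow_eq_zero_iff two_ne_zero |>.1 (le_antisymm h1 (sq_nonneg _))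
    rw [highExcess, ← hu, hc]
    nlinarith [mul_nonneg hw0 hv0, mul_pos hv hv]
  · refine lt_of_lt_of_le ?_ hle
    nlinarith [mul_nonneg hu.le hw0, mul_nonneg hv0 hw0]

/-- If Π_uu = 1, the edge ux forces Π_ux = -1, and the row of u would have squared norm at least 2
instead of 1. -/
theorem edgeProj_diag_lt_one (hF : edgeGram H F ≠ 0) {u x : V} (hux : s(u, x) ∈ F) :
    edgeProj H F u u < 1 := by
  have hadj : H.Adj u x := (SimpleGraph.mem_edgeSet H).1 (mem_edgeSet_of_edgeGram_ne_zero hF hux)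
  have hle : edgeProj H F u u ≤ 1 := complProj_diag_le_one hF u
  refine hle.lt_of_ne fun h1 => ?_
  have hsum : ∑ y ∈ ({u, x} : Finset V), edgeProj H F u y ^ 2 ≤ edgeProj H F u u := by
    rw [show edgeProj H F u u = ∑ y, edgeProj H F u y ^ 2 from complProj_diag hF u]
    exact Finset.sum_le_sum_of_subset_of_nonneg (Finset.subset_univ _) fun _ _ _ => sq_nonneg _
  rw [Finset.sum_insert (by simp [hadj.ne]), Finset.sum_singleton] at hsum
  have h2 := edgeProj_add_eq_zero hF hux u
  rw [show edgeProj H F x u = edgeProj H F u x from complProj_comm _ _ _] at h2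
  have h3 : edgeProj H F u x = -1 := by linarith
  rw [h1, h3] at hsum
  norm_num at hsum

theorem trace_edgeProj (hF : edgeGram H F ≠ 0) :
    (edgeProj H F).trace = Fintype.card V - F.card := by
  rw [edgeProj, trace_complProj hF, Fintype.card_coe]

/-- A nonzero alternating function on a set of vertices forces the projection to have trace at
least one on this set. -/
theorem one_le_sum_edgeProj (hF : edgeGram H F ≠ 0) {K : Finset V} (hne : K.Nonempty)
    {y : V → ℝ} (hy1 : ∀ x ∈ K, y x ^ 2 = 1) (hy0 : ∀ x ∉ K, y x = 0)
    (hy : ∀ a b, s(a, b) ∈ F → y a + y b = 0) : 1 ≤ ∑ x ∈ K, edgeProj H F x x := by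
  have hcard : ∑ x, y x ^ 2 = K.card := by
    rw [← Finset.sum_subset (Finset.subset_univ K) (fun x _ hx => by rw [hy0 x hx]; norm_num),
      Finset.sum_congr rfl hy1]
    simp
  have hpos : (0 : ℝ) < K.card := by exact_mod_cast hne.card_pos
  -- Cauchy-Schwarz applied to y x = (Πy) x, with |y|² = |K| and |row x|² = Π_xx.
  have key : ∀ x ∈ K, 1 / (K.card : ℝ) ≤ edgeProj H F x x := by
    intro x hx
    have h1 : ∑ z, edgeProj H F x z * y z = y x := congrFun (edgeProj_mulVec hF hy) x
    have h2 := Finset.sum_mul_sq_le_sq_mul_sq Finset.univ (fun z => edgeProj H F x z) y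
    rw [h1, hy1 x hx, hcard,
      ← show edgeProj H F x x = ∑ z, edgeProj H F x z ^ 2 from complProj_diag hF x] at h2
    rwa [div_le_iff₀ hpos]
  calc (1 : ℝ) = ∑ x ∈ K, 1 / (K.card : ℝ) := by
        rw [Finset.sum_const, nsmul_eq_mul]; field_simp
    _ ≤ _ := Finset.sum_le_sum key

end edgeProj

/-! ### Producing independent edge sets by basis extension -/

section extension

variable {V : Type*} [Fintype V] [DecidableEq V] {H : SimpleGraph V} {F : Finset (Sym2 V)}

/-- The coordinate vectors and the incidence vectors. -/
noncomputable def vertexEdgeVector (H : SimpleGraph V) : V ⊕ Sym2 V → V → ℝ :=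
  Sum.elim (fun x => Pi.single x 1) (fun e x => realInc H x e)

theorem edgeGram_ne_zero_of_linearIndepOn
    (h : LinearIndepOn ℝ (vertexEdgeVector H) (Sum.inr '' (F : Set (Sym2 V)))) :
    edgeGram H F ≠ 0 := by
  intro h0
  obtain ⟨x, hx, hx0⟩ := Matrix.exists_mulVec_eq_zero_iff.2 h0
  have h1 : columns (realInc H) F *ᵥ x = 0 := by
    have h2 : (columns (realInc H) F *ᵥ x) ⬝ᵥ (columns (realInc H) F *ᵥ x) = 0 := by
      rw [Matrix.dotProduct_mulVec, ← Matrix.mulVec_transpose, Matrix.mulVec_mulVec, hx0,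
        zero_dotProduct]
    exact dotProduct_self_eq_zero.1 h2
  have h3 : LinearIndependent ℝ (fun e : F => fun y => realInc H y e.1) :=
    h.comp (fun e : F => (⟨Sum.inr e.1, e.1, e.2, rfl⟩ : (Sum.inr '' (F : Set (Sym2 V)) : Set _)))
      (fun a b hab => Subtype.ext (Sum.inr_injective (Subtype.ext_iff.1 hab)))
  refine hx (funext (Fintype.linearIndependent_iff.1 h3 x ?_))
  funext y
  have := congrFun h1 y
  simpa [Matrix.mulVec, dotProduct, columns, mul_comm] using this

/-- A zero diagonal entry makes the whole column of Π at u vanish, which puts the coordinate vector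
of u in the span of the columns of F. -/
theorem edgeProj_diag_ne_zero_of_linearIndepOn {u : V}
    (h : LinearIndepOn ℝ (vertexEdgeVector H) (insert (Sum.inl u) (Sum.inr '' (F : Set (Sym2 V))))) :
    edgeProj H F u u ≠ 0 := by
  have hF : edgeGram H F ≠ 0 := edgeGram_ne_zero_of_linearIndepOn (h.mono (Set.subset_insert _ _))
  intro h0
  have hnot := h.notMem_span_of_insert (by simp)
  refine hnot ?_
  have hcol : ∀ y, edgeProj H F y u = 0 := by
    intro y
    have h1 : edgeProj H F u y ^ 2 ≤ edgeProj H F u u := sq_le_complProj_diag hF u y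
    rw [h0] at h1
    rw [show edgeProj H F y u = edgeProj H F u y from complProj_comm _ _ _]
    exact pow_eq_zero_iff two_ne_zero |>.1 (le_antisymm h1 (sq_nonneg _))
  set A := columns (realInc H) F with hA
  have hv : vertexEdgeVector H (Sum.inl u) = A *ᵥ (((Aᵀ * A)⁻¹ * Aᵀ) *ᵥ Pi.single u 1) := by
    rw [Matrix.mulVec_mulVec, ← Matrix.mul_assoc]
    funext y
    have h2 : (1 : Matrix V V ℝ) y u - (A * (Aᵀ * A)⁻¹ * Aᵀ) y u = 0 := hcol y
    rw [Matrix.mulVec_single_one, Matrix.col_apply, ← sub_eq_zero.1 h2]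
    simp [vertexEdgeVector, Matrix.one_apply, Pi.single_apply]
  rw [hv]
  have h3 : ∀ c : F → ℝ, A *ᵥ c = ∑ e, c e • vertexEdgeVector H (Sum.inr e.1) := by
    intro c
    funext y
    simp [Matrix.mulVec, dotProduct, hA, columns, vertexEdgeVector, mul_comm]
  rw [h3]
  exact Submodule.sum_mem _ fun e _ => Submodule.smul_mem _ _
    (Submodule.subset_span ⟨Sum.inr e.1, ⟨e.1, e.2, rfl⟩, rfl⟩)

/-- Extension of an independent set of coordinate and incidence vectors to a basis. -/
theorem exists_edges_extension (X : Finset V) (A : Finset (Sym2 V)) (hA : ∀ e ∈ A, e ∈ H.edgeSet)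
    (hind : LinearIndepOn ℝ (vertexEdgeVector H)
      (Sum.inl '' (X : Set V) ∪ Sum.inr '' (A : Set (Sym2 V))))
    (hspan : ∀ y : V → ℝ, (∀ x ∈ X, y x = 0) → (∀ a b, H.Adj a b → y a + y b = 0) → y = 0) :
    ∃ F : Finset (Sym2 V), A ⊆ F ∧ F.card + X.card = Fintype.card V ∧
      LinearIndepOn ℝ (vertexEdgeVector H)
        (Sum.inl '' (X : Set V) ∪ Sum.inr '' (F : Set (Sym2 V))) := by
  classical
  obtain ⟨b, hbt, hsb, htb, hb⟩ := exists_linearIndepOn_extension hind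
    (t := Sum.inl '' (X : Set V) ∪ Sum.inr '' H.edgeSet)
    (Set.union_subset_union_right _ (Set.image_mono fun e he => hA e he))
  set F : Finset (Sym2 V) := Finset.univ.filter fun e => Sum.inr e ∈ b with hF
  have hbF : b = Sum.inl '' (X : Set V) ∪ Sum.inr '' (F : Set (Sym2 V)) := by
    ext z
    rcases z with x | e
    · constructor
      · intro h
        rcases hbt h with h | ⟨_, _, h⟩
        · exact Or.inl h
        · cases h
      · rintro (h | ⟨_, _, h⟩)
        · exact hsb (Or.inl h)
        · cases h
    · simp [hF]
  rw [hbF] at hb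
  refine ⟨F, fun e he => by simpa [hF] using hsb (Or.inr ⟨e, he, rfl⟩), ?_, hb⟩
  -- A functional killing the span is a function that vanishes on X and alternates on H, hence zero
  -- by `hspan`.
  have htop : Submodule.span ℝ (vertexEdgeVector H '' b) = ⊤ := by
    by_contra hne
    obtain ⟨f, hf, hfb⟩ := Submodule.exists_le_ker_of_lt_top _ (lt_top_iff_ne_top.2 hne)
    have hmem : ∀ z ∈ (Sum.inl '' (X : Set V) ∪ Sum.inr '' H.edgeSet : Set (V ⊕ Sym2 V)),
        f (vertexEdgeVector H z) = 0 := fun z hz => hfb (htb ⟨z, hz, rfl⟩)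
    have hy := hspan (fun x => f (Pi.single x 1))
      (fun x hx => hmem _ (Or.inl ⟨x, hx, rfl⟩)) (fun a c hac => by
        have := hmem (Sum.inr s(a, c)) (Or.inr ⟨s(a, c), hac, rfl⟩)
        rw [← this, ← map_add]
        congr 1
        funext x
        simp [vertexEdgeVector, realInc_apply hac, Pi.single_apply])
    exact hf (LinearMap.pi_ext' fun x => LinearMap.ext_ring (congrFun hy x))
  have hli : LinearIndependent ℝ (fun z : b => vertexEdgeVector H z) := by rw [hbF]; exact hb
  have hbas := Module.finrank_eq_card_basis (Module.Basis.mk hli (by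
    rw [← Set.image_eq_range, htop]))
  rw [Module.finrank_pi] at hbas
  rw [hbas, ← Set.toFinset_card]
  have : b.toFinset = X.disjSum F := by
    ext z
    rw [Set.mem_toFinset, hbF]
    rcases z with x | e <;> simp
  rw [this, Finset.card_disjSum, add_comm]

end extension

/-! ### Cycle bases -/

section cycleBasis

variable {V : Type*} [DecidableEq V] {G : SimpleGraph V}

/-- The paths that a vertex on a cycle and another vertex on it cut the cycle into. -/
theorem IsCycleOf.exists_split [Fintype V] {C : Finset (Sym2 V)} (hC : IsCycleOf G C) {a b : V}
    (ha : a ∈ cycleVerts C) (hb : b ∈ cycleVerts C) (hab : a ≠ b) :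
    ∃ (q : G.Walk a b) (r : G.Walk b a), q.IsPath ∧ r.IsPath ∧
      Disjoint q.edges.toFinset r.edges.toFinset ∧ q.edges.toFinset ∪ r.edges.toFinset = C := by
  obtain ⟨x, p, hp, rfl⟩ := hC
  have hmem : ∀ z, z ∈ cycleVerts p.edges.toFinset → z ∈ p.support := by
    intro z hz
    simp only [cycleVerts, Finset.mem_filter, List.mem_toFinset] at hz
    obtain ⟨-, e, he, hze⟩ := hz
    exact p.mem_support_of_mem_edges he hze
  have ha' := hmem a ha
  have hb' : b ∈ (p.rotate a ha').support := by
    rw [SimpleGraph.Walk.mem_support_rotate_iff]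
    exact hmem b hb
  have hcyc : (p.rotate a ha').IsCycle := hp.rotate ha'
  have hedges : (p.rotate a ha').edges.toFinset = p.edges.toFinset := by
    ext e
    simp only [List.mem_toFinset]
    exact (p.rotate_edges a ha').mem_iff
  rw [← hedges]
  set c := p.rotate a ha' with hc
  have hspec := c.take_spec hb'
  have hnd : ((c.takeUntil b hb').edges ++ (c.dropUntil b hb').edges).Nodup := by
    rw [← SimpleGraph.Walk.edges_append, hspec]
    exact hcyc.edges_nodup
  refine ⟨c.takeUntil b hb', c.dropUntil b hb', hcyc.isPath_takeUntil hb', ?_, ?_, ?_⟩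
  · rw [← hspec] at hcyc
    exact hcyc.isPath_of_append_right (SimpleGraph.Walk.not_nil_of_ne hab)
  · rw [List.disjoint_toFinset_iff_disjoint]
    exact List.disjoint_of_nodup_append hnd
  · rw [← List.toFinset_append, ← SimpleGraph.Walk.edges_append, hspec]

theorem isCycleOf_insert_edge {a b : V} (p : G.Walk a b) (hp : p.IsPath) (h : G.Adj a b)
    (hn : s(a, b) ∉ p.edges) : IsCycleOf G (insert s(a, b) p.edges.toFinset) := by
  refine ⟨b, SimpleGraph.Walk.cons h.symm p, ?_, ?_⟩
  · rw [SimpleGraph.Walk.cons_isCycle_iff]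
    exact ⟨hp, by rwa [Sym2.eq_swap]⟩
  · rw [SimpleGraph.Walk.edges_cons, List.toFinset_cons, Sym2.eq_swap]

theorem card_edges_toFinset_of_isPath {a b : V} {p : G.Walk a b} (hp : p.IsPath) :
    p.edges.toFinset.card = p.length := by
  rw [List.toFinset_card_of_nodup hp.isTrail.edges_nodup, SimpleGraph.Walk.length_edges]

theorem two_le_length_of_not_mem {V : Type*} {G : SimpleGraph V} {a b : V} {p : G.Walk a b} (hab : a ≠ b)
    (hn : s(a, b) ∉ p.edges) : 2 ≤ p.length := by
  match p with
  | .nil => exact absurd rfl hab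
  | .cons h .nil => simp at hn
  | .cons _ (.cons _ _) => simp

/-- A cycle with a chord is the sum of two shorter cycles. -/
theorem IsCycleOf.exists_add_of_chord [Fintype V] {C : Finset (Sym2 V)} (hC : IsCycleOf G C)
    {a b : V} (ha : a ∈ cycleVerts C) (hb : b ∈ cycleVerts C) (h : G.Adj a b)
    (hn : s(a, b) ∉ C) :
    ∃ D D', IsCycleOf G D ∧ IsCycleOf G D' ∧ D.card < C.card ∧ D'.card < C.card ∧
      edgeVector D + edgeVector D' = edgeVector C := by
  obtain ⟨q, r, hq, hr, hdisj, rfl⟩ := hC.exists_split ha hb h.ne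
  simp only [Finset.mem_union, List.mem_toFinset, not_or] at hn
  have hnr : s(b, a) ∉ r.edges := by rw [Sym2.eq_swap]; exact hn.2
  have hq2 := two_le_length_of_not_mem h.ne hn.1
  have hr2 := two_le_length_of_not_mem h.ne.symm hnr
  refine ⟨_, _, isCycleOf_insert_edge q hq h hn.1, isCycleOf_insert_edge r hr h.symm hnr,
    ?_, ?_, ?_⟩
  · rw [Finset.card_insert_of_notMem (by simpa using hn.1), Finset.card_union_of_disjoint hdisj,
      card_edges_toFinset_of_isPath hq, card_edges_toFinset_of_isPath hr]
    omega
  · rw [Finset.card_insert_of_notMem (by simpa using hnr), Finset.card_union_of_disjoint hdisj,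
      card_edges_toFinset_of_isPath hq, card_edges_toFinset_of_isPath hr]
    omega
  · funext e
    rw [Finset.disjoint_left] at hdisj
    have hd := @hdisj e
    simp only [List.mem_toFinset] at hd
    simp only [edgeVector, Pi.add_apply, Finset.mem_insert, Finset.mem_union, List.mem_toFinset]
    rw [Sym2.eq_swap (a := b) (b := a)]
    by_cases he : e = s(a, b)
    · subst he
      simp [hn, CharTwo.add_self_eq_zero]
    · by_cases h1 : e ∈ q.edges <;> by_cases h2 : e ∈ r.edges <;> simp_all

/-- The cycles of a minimum cycle basis have no chords. -/
theorem IsMinimumCycleBasis.mem_of_adj [Fintype V] {B : Finset (Finset (Sym2 V))}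
    (hB : IsMinimumCycleBasis G B) {C : Finset (Sym2 V)} (hC : C ∈ B) {a b : V}
    (ha : a ∈ cycleVerts C) (hb : b ∈ cycleVerts C) (h : G.Adj a b) : s(a, b) ∈ C := by
  obtain ⟨⟨hcyc, hind, hspan⟩, hmin⟩ := hB
  by_contra hn
  obtain ⟨D₁, D₂, hD₁, hD₂, hc₁, hc₂, hadd⟩ := (hcyc C hC).exists_add_of_chord ha hb h hn
  set B₀ := B.erase C with hB₀
  have hBins : insert C B₀ = B := Finset.insert_erase hC
  have hCnot : edgeVector C ∉ Submodule.span (ZMod 2) (edgeVector '' (B₀ : Set _)) := by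
    rw [← hBins, Finset.coe_insert] at hind
    exact hind.notMem_span_of_insert (by simp [hB₀])
  -- The vector of C lies outside the span of the other basis cycles, so one of the two shorter
  -- summands does too. Exchanging it for C gives a basis of smaller total length.
  obtain ⟨D, hD, hcard, hDnot⟩ : ∃ D, IsCycleOf G D ∧ D.card < C.card ∧
      edgeVector D ∉ Submodule.span (ZMod 2) (edgeVector '' (B₀ : Set _)) := by
    by_contra hno
    push Not at hno
    exact hCnot (hadd ▸ Submodule.add_mem _ (hno D₁ hD₁ hc₁) (hno D₂ hD₂ hc₂))
  have hDB₀ : D ∉ B₀ := fun hmem => hDnot (Submodule.subset_span ⟨D, hmem, rfl⟩)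
  have hCspan : edgeVector C ∈
      Submodule.span (ZMod 2) (edgeVector '' ((insert D B₀ : Finset _) : Set _)) := by
    have h1 := hspan D hD
    rw [← hBins, Finset.coe_insert, Set.image_insert_eq] at h1
    rw [Finset.coe_insert, Set.image_insert_eq]
    exact mem_span_insert_exchange h1 hDnot
  have hnew : IsCycleBasis G (insert D B₀) := by
    refine ⟨?_, ?_, ?_⟩
    · intro E hE
      rcases Finset.mem_insert.1 hE with rfl | hE
      · exact hD
      · exact hcyc E (Finset.mem_of_mem_erase hE)
    · rw [Finset.coe_insert]
      exact (hind.mono (by simp [hB₀])).insert hDnot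
    · intro E hE
      refine Submodule.span_le.2 ?_ (hspan E hE)
      rintro _ ⟨E', hE', rfl⟩
      by_cases hEC : E' = C
      · rw [hEC]; exact hCspan
      · exact Submodule.subset_span ⟨E', Finset.mem_coe.2
          (Finset.mem_insert_of_mem (Finset.mem_erase.2 ⟨hEC, hE'⟩)), rfl⟩
  have := hmin _ hnew
  rw [Finset.sum_insert hDB₀, ← hBins, Finset.sum_insert (by simp [hB₀])] at this
  omega

/-- A pair of edges that every basis cycle contains both or none of has this property for all
cycles. -/
theorem IsCycleBasis.mem_iff_mem {B : Finset (Finset (Sym2 V))} (hB : IsCycleBasis G B)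
    {e f : Sym2 V} (h : ∀ C ∈ B, e ∈ C ↔ f ∈ C) {C : Finset (Sym2 V)} (hC : IsCycleOf G C) :
    e ∈ C ↔ f ∈ C := by
  have hle : Submodule.span (ZMod 2) (edgeVector '' (B : Set (Finset (Sym2 V)))) ≤
      LinearMap.ker (LinearMap.proj (R := ZMod 2) (φ := fun _ : Sym2 V => ZMod 2) e -
        LinearMap.proj f) := by
    rw [Submodule.span_le]
    rintro _ ⟨D, hD, rfl⟩
    have := h D hD
    simp only [SetLike.mem_coe, LinearMap.mem_ker, LinearMap.sub_apply, LinearMap.proj_apply,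
      edgeVector]
    by_cases he : e ∈ D <;> simp_all
  have := hle (hB.2.2 C hC)
  simp only [LinearMap.mem_ker, LinearMap.sub_apply, LinearMap.proj_apply, edgeVector] at this
  by_cases he : e ∈ C <;> by_cases hf : f ∈ C <;> simp_all

end cycleBasis

theorem mem_cycleVerts {V : Type*} [Fintype V] [DecidableEq V] {C : Finset (Sym2 V)} {x y : V}
    (h : s(x, y) ∈ C) : x ∈ cycleVerts C ∧ y ∈ cycleVerts C := by
  constructor <;> simp only [cycleVerts, Finset.mem_filter, Finset.mem_univ, true_and] <;>
    exact ⟨_, h, by simp⟩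

/-! ### The graph without the two edges -/

section cutGraph

variable {V : Type*} {G : SimpleGraph V} {u v w : V}

/-- A set closed under adjacency contains everything that is reachable from it. -/
theorem SimpleGraph.Reachable.mem_of_closed {S : Set V} (hS : ∀ a b, G.Adj a b → a ∈ S → b ∈ S)
    {a b : V} (h : G.Reachable a b) (ha : a ∈ S) : b ∈ S := by
  obtain ⟨p⟩ := h
  induction p with
  | nil => exact ha
  | cons h _ ih => exact ih (hS _ _ h ha)

theorem IsCycleOf.mono [DecidableEq V] {G' : SimpleGraph V} (hle : G ≤ G') {C : Finset (Sym2 V)}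
    (hC : IsCycleOf G C) : IsCycleOf G' C ∧ ∀ e ∈ C, e ∈ G.edgeSet := by
  obtain ⟨x, p, hp, rfl⟩ := hC
  have hsub : ∀ e ∈ p.edges, e ∈ G.edgeSet := fun e he => p.edges_subset_edgeSet he
  refine ⟨⟨x, p.transfer G' fun e he => SimpleGraph.edgeSet_mono hle (hsub e he),
    hp.transfer _, by rw [SimpleGraph.Walk.edges_transfer]⟩, fun e he => hsub e (by simpa using he)⟩

theorem IsCycleOf.of_edges_mem [DecidableEq V] {G' : SimpleGraph V} {C : Finset (Sym2 V)}
    (hC : IsCycleOf G C) (h : ∀ e ∈ C, e ∈ G'.edgeSet) : IsCycleOf G' C := by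
  obtain ⟨x, p, hp, rfl⟩ := hC
  exact ⟨x, p.transfer G' fun e he => h e (by simpa using he), hp.transfer _,
    by rw [SimpleGraph.Walk.edges_transfer]⟩

theorem IsCycleOf.reachable_deleteEdges [DecidableEq V] {C : Finset (Sym2 V)}
    (hC : IsCycleOf G C) (h : s(u, v) ∈ C) :
    (G.deleteEdges {s(u, v)}).Reachable u v := by
  obtain ⟨x, p, hp, rfl⟩ := hC
  exact (SimpleGraph.adj_and_reachable_delete_edges_iff_exists_cycle.2
    ⟨x, p, hp, by simpa using h⟩).2

/-- If all cycles contain both or none of two edges, then these edges separate. -/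
theorem not_reachable_deleteEdges_pair [DecidableEq V] {a b : V} {f : Sym2 V} (hab : G.Adj a b)
    (hne : s(a, b) ≠ f) (hcyc : ∀ C, IsCycleOf G C → s(a, b) ∈ C → f ∈ C) :
    ¬ (G.deleteEdges {s(a, b), f}).Reachable a b := by
  intro h
  have h1 : (G.deleteEdges {f}).Adj a b := by
    rw [SimpleGraph.deleteEdges_adj]
    exact ⟨hab, by simpa using hne⟩
  have h2 : ((G.deleteEdges {f}).deleteEdges {s(a, b)}).Reachable a b := by
    rw [SimpleGraph.deleteEdges_deleteEdges, Set.union_comm]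
    exact h
  obtain ⟨x, p, hp, hmem⟩ :=
    SimpleGraph.adj_and_reachable_delete_edges_iff_exists_cycle.1 ⟨h1, h2⟩
  obtain ⟨h3, h4⟩ := IsCycleOf.mono (G.deleteEdges_le {f})
    (⟨x, p, hp, rfl⟩ : IsCycleOf (G.deleteEdges {f}) p.edges.toFinset)
  have h5 := h4 f (hcyc _ h3 (by simpa using hmem))
  rw [SimpleGraph.edgeSet_deleteEdges] at h5
  exact h5.2 rfl

theorem cutGraph_adj_of {a b : V} (h : G.Adj a b) (h1 : s(a, b) ≠ s(u, v))
    (h2 : s(a, b) ≠ s(v, w)) : (cutGraph G u v w).Adj a b := by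
  rw [SimpleGraph.deleteEdges_adj]
  exact ⟨h, by simp [h1, h2]⟩

/-- Otherwise the component of u without the two edges would be closed under adjacency in G - uv;
but the cycle through uv connects u to v there. -/
theorem cutGraph_reachable [DecidableEq V] (hv : ¬ (cutGraph G u v w).Reachable u v)
    {C : Finset (Sym2 V)} (hC : IsCycleOf G C) (huv : s(u, v) ∈ C) :
    (cutGraph G u v w).Reachable u w := by
  by_contra hw
  refine hv (SimpleGraph.Reachable.mem_of_closed
    (S := {x | (cutGraph G u v w).Reachable u x}) ?_ (hC.reachable_deleteEdges huv)
    (SimpleGraph.Reachable.refl u))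
  intro a b hab ha
  rw [SimpleGraph.deleteEdges_adj] at hab
  refine ha.trans (cutGraph_adj_of hab.1 (by simpa using hab.2) fun h => ?_).reachable
  rcases Sym2.eq_iff.1 h with ⟨rfl, rfl⟩ | ⟨rfl, rfl⟩
  · exact hv ha
  · exact hw ha

theorem cutGraph_reachable_or (hG : G.Connected) (huw : (cutGraph G u v w).Reachable u w) (x : V) :
    (cutGraph G u v w).Reachable u x ∨ (cutGraph G u v w).Reachable v x := by
  refine SimpleGraph.Reachable.mem_of_closed
    (S := {x | (cutGraph G u v w).Reachable u x ∨ (cutGraph G u v w).Reachable v x}) ?_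
    (hG.preconnected u x) (Or.inl (SimpleGraph.Reachable.refl u))
  intro a b hab ha
  by_cases h1 : s(a, b) = s(u, v)
  · rcases Sym2.eq_iff.1 h1 with ⟨rfl, rfl⟩ | ⟨rfl, rfl⟩
    · exact Or.inr (SimpleGraph.Reachable.refl _)
    · exact Or.inl (SimpleGraph.Reachable.refl _)
  by_cases h2 : s(a, b) = s(v, w)
  · rcases Sym2.eq_iff.1 h2 with ⟨rfl, rfl⟩ | ⟨rfl, rfl⟩
    · exact Or.inl huw
    · exact Or.inr (SimpleGraph.Reachable.refl _)
  have := (cutGraph_adj_of hab h1 h2).reachable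
  exact ha.imp (fun h => h.trans this) (fun h => h.trans this)

end cutGraph

/-! ### Odd cycles -/

section bipartite

variable {V : Type*} [DecidableEq V] {H : SimpleGraph V}

/-- Each loop erased by `bypass` is either a cycle or one edge traversed back and forth, so it has
even length. -/
theorem length_bypass_parity (heven : ∀ C, IsCycleOf H C → ¬ Odd C.card) {a b : V}
    (p : H.Walk a b) : Even (p.length + p.bypass.length) := by
  induction p with
  | nil => exact Even.zero
  | @cons a c b h q ih =>
    rw [SimpleGraph.Walk.bypass]
    by_cases hmem : a ∈ q.bypass.support
    · simp only [hmem, dif_pos, SimpleGraph.Walk.length_cons]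
      have hpath : (q.bypass.takeUntil a hmem).IsPath := q.bypass_isPath.takeUntil hmem
      have hlen : (q.bypass.takeUntil a hmem).length + (q.bypass.dropUntil a hmem).length =
          q.bypass.length := by
        rw [← SimpleGraph.Walk.length_append, SimpleGraph.Walk.take_spec]
      have hodd : Even ((q.bypass.takeUntil a hmem).length + 1) := by
        generalize q.bypass.takeUntil a hmem = t at hpath
        by_cases hac : s(c, a) ∈ t.edges
        · have h1 : t.length = 1 := by
            have := hpath.length_eq_one_of_mem_edges hac
            exact this
          rw [h1]; decide
        · have hc := isCycleOf_insert_edge t hpath h.symm hac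
          have := heven _ hc
          rw [Finset.card_insert_of_notMem (by simpa using hac),
            card_edges_toFinset_of_isPath hpath] at this
          exact Nat.not_odd_iff_even.1 this
      rw [← hlen] at ih
      have : (q.length + 1 + (q.bypass.dropUntil a hmem).length) + 2 *
          (q.bypass.takeUntil a hmem).length = (q.length + ((q.bypass.takeUntil a hmem).length +
          (q.bypass.dropUntil a hmem).length)) + ((q.bypass.takeUntil a hmem).length + 1) := by
        ring
      have h2 := ih.add hodd
      rw [← this] at h2
      exact (Nat.even_add.1 h2).2 (even_two_mul _)
    · simp only [hmem, dif_neg, not_false_eq_true, SimpleGraph.Walk.length_cons]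
      have : q.length + 1 + (q.bypass.length + 1) = q.length + q.bypass.length + 2 := by ring
      rw [this]
      exact ih.add even_two

/-- A graph without odd cycles has an alternating sign function. -/
theorem exists_alternating (heven : ∀ C, IsCycleOf H C → ¬ Odd C.card) :
    ∃ y : V → ℝ, (∀ x, y x ^ 2 = 1) ∧ ∀ a b, H.Adj a b → y a + y b = 0 := by
  have h2 : H.Colorable 2 := by
    rw [SimpleGraph.two_colorable_iff_forall_loop_even]
    intro a p
    have := length_bypass_parity heven p
    have h0 : p.bypass.length = 0 := by
      exact SimpleGraph.Walk.length_eq_zero_iff.2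
        (SimpleGraph.Walk.isPath_iff_nil.1 p.bypass_isPath)
    rwa [h0, add_zero] at this
  obtain ⟨c⟩ := h2
  refine ⟨fun x => if c x = 0 then 1 else -1, fun x => ?_, fun a b hab => ?_⟩
  · dsimp only
    split_ifs <;> norm_num
  · have := c.valid hab
    dsimp only
    generalize c a = i at this ⊢
    generalize c b = j at this ⊢
    fin_cases i <;> fin_cases j <;> simp_all

/-- An alternating function vanishes on an odd closed walk. -/
theorem eq_zero_of_odd_closed {V : Type*} {H : SimpleGraph V} {y : V → ℝ} (hy : ∀ a b, H.Adj a b → y a + y b = 0) {a : V}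
    (p : H.Walk a a) (hp : Odd p.length) : y a = 0 := by
  have key : ∀ {a b : V} (p : H.Walk a b), y b = (-1) ^ p.length * y a := by
    intro a b p
    induction p with
    | nil => simp
    | cons h q ih =>
      rw [ih, SimpleGraph.Walk.length_cons, pow_succ]
      linear_combination (-1) ^ q.length * hy _ _ h
  have := key p
  rw [hp.neg_one_pow] at this
  linarith

theorem eq_zero_of_reachable {V : Type*} {H : SimpleGraph V} {y : V → ℝ} (hy : ∀ a b, H.Adj a b → y a + y b = 0) {a b : V}
    (h : H.Reachable a b) (ha : y a = 0) : y b = 0 :=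
  h.mem_of_closed (S := {x | y x = 0}) (fun c d hcd hc => by
    have := hy c d hcd
    rw [Set.mem_ofPred_eq] at hc ⊢
    linarith) ha

end bipartite

/-! ### The shortened cycle -/

section shortenedCycle

variable {V : Type*} [DecidableEq V] {G : SimpleGraph V}

/-- Removing an edge from a cycle leaves a path. -/
theorem IsCycleOf.exists_path [Fintype V] {C : Finset (Sym2 V)} (hC : IsCycleOf G C) {a b : V}
    (h : s(a, b) ∈ C) :
    ∃ p : G.Walk b a, p.IsPath ∧ s(a, b) ∉ p.edges ∧ C = insert s(a, b) p.edges.toFinset := by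
  have hadj : G.Adj a b := (hC.mono le_rfl).2 _ h
  obtain ⟨q, r, hq, hr, hdisj, rfl⟩ :=
    hC.exists_split (mem_cycleVerts h).1 (mem_cycleVerts h).2 hadj.ne
  have single : ∀ {a b : V} (t : G.Walk a b), t.IsPath → s(a, b) ∈ t.edges →
      t.edges.toFinset = {s(a, b)} := by
    intro a b t ht hmem
    have h1 : t.edges.toFinset.card = 1 := by
      rw [card_edges_toFinset_of_isPath ht, ht.length_eq_one_of_mem_edges hmem]
    obtain ⟨e, he⟩ := Finset.card_eq_one.1 h1
    have : s(a, b) ∈ t.edges.toFinset := by simpa using hmem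
    rw [he, Finset.mem_singleton] at this
    rw [he, this]
  rcases Finset.mem_union.1 h with h1 | h1
  · have hs := single q hq (by simpa using h1)
    rw [hs, Finset.disjoint_singleton_left] at hdisj
    exact ⟨r, hr, by simpa using hdisj, by rw [hs, Finset.insert_eq]⟩
  · have hs := single r hr (by rw [Sym2.eq_swap]; simpa using h1)
    rw [hs, Finset.disjoint_singleton_right, Sym2.eq_swap] at hdisj
    refine ⟨q.reverse, hq.reverse, by simpa using hdisj, ?_⟩
    rw [hs, Finset.union_comm, Sym2.eq_swap, SimpleGraph.Walk.edges_reverse,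
      List.toFinset_reverse, Finset.insert_eq]

/-- The only edge of a path at its first vertex is its first edge. -/
theorem exists_path_of_mem_edges {V : Type*} {G : SimpleGraph V} {a b c : V} (p : G.Walk a c) (hp : p.IsPath)
    (h : s(a, b) ∈ p.edges) :
    ∃ q : G.Walk b c, q.IsPath ∧ a ∉ q.support ∧ p.edges = s(a, b) :: q.edges := by
  cases p with
  | nil => simp at h
  | @cons _ d _ hadj q =>
    rw [SimpleGraph.Walk.cons_isPath_iff] at hp
    rw [SimpleGraph.Walk.edges_cons, List.mem_cons] at h
    rcases h with h | h
    · obtain rfl : b = d := by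
        rcases Sym2.eq_iff.1 h with ⟨-, h⟩ | ⟨h1, h2⟩
        · exact h
        · exact absurd h1 hadj.ne
      exact ⟨q, hp.1, hp.2, by simp⟩
    · exact absurd (q.fst_mem_support_of_mem_edges h) hp.2

theorem cycleVerts_insert_edges [Fintype V] {a b c d : V} (p : G.Walk c d) (hp : ¬ p.Nil)
    (S : Finset (Sym2 V)) :
    cycleVerts (insert s(a, b) (S ∪ p.edges.toFinset)) =
      insert a (insert b (cycleVerts S ∪ p.support.toFinset)) := by
  ext x
  simp only [cycleVerts, Finset.mem_filter, Finset.mem_univ, true_and, Finset.mem_insert,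
    Finset.mem_union, List.mem_toFinset]
  rw [p.mem_support_iff_exists_mem_edges_of_not_nil hp]
  constructor
  · rintro ⟨e, rfl | he | he, hx⟩
    · rcases Sym2.mem_iff.1 hx with rfl | rfl <;> simp
    · exact Or.inr (Or.inr (Or.inl ⟨e, he, hx⟩))
    · exact Or.inr (Or.inr (Or.inr ⟨e, he, hx⟩))
  · rintro (rfl | rfl | ⟨e, he, hx⟩ | ⟨e, he, hx⟩)
    · exact ⟨_, Or.inl rfl, by simp⟩
    · exact ⟨_, Or.inl rfl, by simp⟩
    · exact ⟨e, Or.inr (Or.inl he), hx⟩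
    · exact ⟨e, Or.inr (Or.inr he), hx⟩

/-- Let z be the vertex after w on the cycle. The stretch u, v, w, z is replaced by the new edge uz,
and the rest of the cycle survives because it avoids v and w. Since v is the only common neighbour
of u and w, uz was not an edge before. -/
theorem exists_shortened_cycle [Fintype V] {u v w : V} {C : Finset (Sym2 V)} (hC : IsCycleOf G C)
    (hu : s(u, v) ∈ C) (hw : s(v, w) ∈ C) (huw : u ≠ w)
    (hNuw : G.neighborSet u ∩ G.neighborSet w = {v}) (hnadj : ¬ G.Adj u w) :
    ∃ C', IsCycleOf (moveEdges G u v w) C' ∧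
      cycleVerts C' = cycleVerts C \ {v, w} ∧ C'.card + 2 = C.card := by
  have hsub := (hC.mono le_rfl).2
  have huv : G.Adj u v := hsub _ hu
  have hvw : G.Adj v w := hsub _ hw
  obtain ⟨p, hp, hpn, rfl⟩ := hC.exists_path hu
  have hpw : s(v, w) ∈ p.edges := by
    rcases Finset.mem_insert.1 hw with h | h
    · exfalso
      rcases Sym2.eq_iff.1 h with ⟨h, -⟩ | ⟨-, h⟩
      · exact huv.ne h.symm
      · exact huw h.symm
    · simpa using h
  obtain ⟨q, hq, hvq, hpq⟩ := exists_path_of_mem_edges p hp hpw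
  cases q with
  | nil => exact absurd rfl huw
  | @cons _ z _ hwz r =>
    rw [SimpleGraph.Walk.cons_isPath_iff] at hq
    simp only [SimpleGraph.Walk.support_cons, List.mem_cons, not_or] at hvq
    have hzv : z ≠ v := by
      rintro rfl
      exact hvq.2 r.start_mem_support
    have hzu : z ≠ u := by
      rintro rfl
      exact hnadj hwz.symm
    have huz : ¬ G.Adj u z := by
      intro h
      have : z ∈ G.neighborSet u ∩ G.neighborSet w := ⟨h, hwz⟩
      rw [hNuw] at this
      exact hzv this
    have hnil : ¬ r.Nil := SimpleGraph.Walk.not_nil_of_ne hzu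
    have hmove : ∀ e ∈ r.edges, e ∈ (moveEdges G u v w).edgeSet := by
      intro e he
      induction e with
      | h a b =>
        have hab := r.adj_of_mem_edges he
        have ha := r.fst_mem_support_of_mem_edges he
        have hb := r.snd_mem_support_of_mem_edges he
        rw [SimpleGraph.mem_edgeSet, moveEdges_adj huv.ne huw hvw.ne]
        refine ⟨hab.ne, Or.inl ⟨hab, ?_, ?_, ?_, ?_⟩⟩
        · rintro rfl; exact hq.2 ha
        · rintro rfl; exact hq.2 hb
        · rintro rfl; exact absurd ha hvq.2
        · rintro rfl; exact absurd hb hvq.2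
    have hadj : (moveEdges G u v w).Adj z u := by
      rw [moveEdges_adj huv.ne huw hvw.ne]
      exact ⟨hzu, Or.inr (Or.inr ⟨rfl, Or.inl ⟨hwz, hzv⟩⟩)⟩
    have hnr : s(z, u) ∉ r.edges := fun h => huz (r.adj_of_mem_edges h).symm
    have hcyc := isCycleOf_insert_edge (r.transfer _ hmove) (hq.1.transfer hmove) hadj
      (by rwa [SimpleGraph.Walk.edges_transfer])
    rw [SimpleGraph.Walk.edges_transfer] at hcyc
    have hCe : insert s(u, v) p.edges.toFinset =
        insert s(u, v) (({s(v, w), s(w, z)} : Finset (Sym2 V)) ∪ r.edges.toFinset) := by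
      rw [hpq, SimpleGraph.Walk.edges_cons]
      ext e
      simp
    refine ⟨_, hcyc, ?_, ?_⟩
    · have h1 := cycleVerts_insert_edges (a := z) (b := u) r hnil ∅
      rw [Finset.empty_union] at h1
      rw [hCe, h1, cycleVerts_insert_edges r hnil]
      ext x
      have hz := r.start_mem_support
      have hu' := r.end_mem_support
      simp only [cycleVerts, Finset.mem_insert, Finset.mem_union, Finset.mem_filter,
        Finset.mem_univ, true_and, List.mem_toFinset, Finset.notMem_empty, false_and, exists_false,
        false_or, Finset.mem_sdiff, Finset.mem_singleton, exists_eq_or_imp, exists_eq_left,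
        Sym2.mem_iff, not_or]
      constructor
      · intro h
        have hx : x ∈ r.support := by
          rcases h with rfl | rfl | h
          · exact hz
          · exact hu'
          · exact h
        refine ⟨Or.inr (Or.inr (Or.inr hx)), ?_, ?_⟩
        · rintro rfl; exact hvq.2 hx
        · rintro rfl; exact hq.2 hx
      · rintro ⟨h, h2, h3⟩
        tauto
    · have hlen : p.length = r.length + 2 := by
        rw [← SimpleGraph.Walk.length_edges, hpq]
        simp
      rw [Finset.card_insert_of_notMem (by simpa using hnr),
        Finset.card_insert_of_notMem (by simpa using hpn), card_edges_toFinset_of_isPath hp,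
        card_edges_toFinset_of_isPath hq.1, hlen]

end shortenedCycle

/-! ### The first two coefficients -/

theorem signlessLaplacianCoeff_zero {V : Type*} [Fintype V] [DecidableEq V]
    (G : SimpleGraph V) : signlessLaplacianCoeff G 0 = 1 := by
  have h := signlessLaplacianCoeff_eq_coeff G (Nat.zero_le _)
  rw [Polynomial.coeff_zero_eq_eval_zero, Matrix.eval_det_one_add_X_smul, zero_smul, add_zero,
    Matrix.det_one] at h
  exact_mod_cast h

theorem trace_signlessLaplacian_realAdj {V : Type*} [Fintype V] [DecidableEq V]
    (G : SimpleGraph V) : (signlessLaplacian (realAdj G)).trace = ∑ x, ∑ y, realAdj G x y := by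
  simp [signlessLaplacian, Matrix.trace, realAdj]

theorem sum_map_apply {α V : Type*} [Fintype α] [Fintype V] [DecidableEq V] (f : α → V)
    (A : Matrix α α ℝ) :
    ∑ x, ∑ y, (mapMatrix f * A * (mapMatrix f)ᵀ) x y = ∑ i, ∑ j, A i j := by
  simp only [Matrix.mul_apply, Matrix.transpose_apply, mapMatrix, Matrix.of_apply]
  simp_rw [Finset.sum_comm (s := (Finset.univ : Finset V)) (t := (Finset.univ : Finset α)),
    ← Finset.mul_sum]
  simp only [Finset.sum_ite_eq, Finset.mem_univ, if_true, mul_one]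
  rw [Finset.sum_comm]
  simp_rw [Finset.sum_comm (s := (Finset.univ : Finset V)) (t := (Finset.univ : Finset α)),
    ← Finset.sum_mul]
  simpa using Finset.sum_comm

theorem signlessLaplacianCoeff_one {V : Type*} [Fintype V] [DecidableEq V] [Nonempty V]
    (G : SimpleGraph V) : (signlessLaplacianCoeff G 1 : ℝ) = ∑ x, ∑ y, realAdj G x y := by
  rw [signlessLaplacianCoeff_eq_coeff G Fintype.card_pos, coeff_det_one_add_X_smul_one,
    trace_signlessLaplacian_realAdj]

/-- Here φ₁ is the sum of all adjacency entries. Merging vertices preserves this sum, and the path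
and the star have two edges each. -/
theorem signlessLaplacianCoeff_one_moveEdges {V : Type*} [Fintype V] [DecidableEq V]
    {G : SimpleGraph V} {u v w : V} (huv : G.Adj u v) (hvw : G.Adj v w) (huw : u ≠ w)
    (hNuv : G.neighborSet u ∩ G.neighborSet v = ∅)
    (hNvw : G.neighborSet v ∩ G.neighborSet w = ∅)
    (hNuw : G.neighborSet u ∩ G.neighborSet w = {v}) :
    signlessLaplacianCoeff G 1 = signlessLaplacianCoeff (moveEdges G u v w) 1 := by
  have : Nonempty V := ⟨u⟩
  have h : (signlessLaplacianCoeff G 1 : ℝ) = signlessLaplacianCoeff (moveEdges G u v w) 1 := by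
    rw [signlessLaplacianCoeff_one, signlessLaplacianCoeff_one,
      realAdj_moveEdges huv hvw huw hNuv hNvw hNuw, realAdj_eq_cutGraph_add huv hvw huw]
    simp only [Matrix.add_apply, Finset.sum_add_distrib, sum_map_apply]
    congr 1
    simp [pathAdj, starAdj, Fin.sum_univ_three]
    norm_num
  exact_mod_cast h

/-! ### Comparison of the coefficients -/

theorem notMem_span_of_functional {ι V : Type*} {f : ι → V → ℝ} {s : Set ι} {i : ι} {x : V}
    (hs : ∀ j ∈ s, f j x = 0) (hi : f i x ≠ 0) : f i ∉ Submodule.span ℝ (f '' s) := by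
  intro h
  have hle : Submodule.span ℝ (f '' s) ≤
      LinearMap.ker (LinearMap.proj (R := ℝ) (φ := fun _ : V => ℝ) x) := by
    rw [Submodule.span_le]
    rintro _ ⟨j, hj, rfl⟩
    exact hs j hj
  exact hi (hle h)

/-- A path `u, v, w` in a connected graph whose vertices have no common neighbours apart from `v`,
such that removing the edges `uv` and `vw` separates `v` from `u` and `w`, but not `u` from `w`. -/
structure IsSeparatingPath {V : Type*} (G : SimpleGraph V) (u v w : V) : Prop where
  connected : G.Connected
  adj_left : G.Adj u v
  adj_right : G.Adj v w
  ne : u ≠ w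
  inter_left : G.neighborSet u ∩ G.neighborSet v = ∅
  inter_right : G.neighborSet v ∩ G.neighborSet w = ∅
  inter_ends : G.neighborSet u ∩ G.neighborSet w = {v}
  not_reachable : ¬ (cutGraph G u v w).Reachable v u
  reachable : (cutGraph G u v w).Reachable u w

namespace IsSeparatingPath

variable {V : Type*} {G : SimpleGraph V} {u v w : V}

theorem not_adj (h : IsSeparatingPath G u v w) : ¬ (cutGraph G u v w).Adj u w := by
  intro h'
  have : w ∈ G.neighborSet u ∩ G.neighborSet v :=
    ⟨(SimpleGraph.deleteEdges_le _) h', h.adj_right⟩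
  rw [h.inter_left] at this
  exact this

theorem not_common (h : IsSeparatingPath G u v w) (x : V) (hx : (cutGraph G u v w).Adj u x) :
    ¬ (cutGraph G u v w).Adj w x := by
  intro hx'
  have : x ∈ G.neighborSet u ∩ G.neighborSet w :=
    ⟨(SimpleGraph.deleteEdges_le _) hx, (SimpleGraph.deleteEdges_le _) hx'⟩
  rw [h.inter_ends] at this
  obtain rfl := this
  exact h.not_reachable hx.symm.reachable

/-- The two components of `cutGraph` are those of u and v, so an alternating function is determined
by these two values. -/
theorem eq_zero (h : IsSeparatingPath G u v w) {y : V → ℝ}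
    (hy : ∀ a b, (cutGraph G u v w).Adj a b → y a + y b = 0) (hu : y u = 0) (hv : y v = 0) :
    y = 0 := by
  funext x
  rcases cutGraph_reachable_or h.connected h.reachable x with hx | hx
  · exact eq_zero_of_reachable hy hx hu
  · exact eq_zero_of_reachable hy hx hv

variable [Fintype V] [DecidableEq V]

theorem closed {F : Finset (Sym2 V)} (hF : edgeGram (cutGraph G u v w) F ≠ 0) {a b : V}
    (hab : s(a, b) ∈ F) :
    (cutGraph G u v w).Reachable v a ↔ (cutGraph G u v w).Reachable v b := by
  have hadj : (cutGraph G u v w).Adj a b :=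
    (SimpleGraph.mem_edgeSet _).1 (mem_edgeSet_of_edgeGram_ne_zero hF hab)
  exact ⟨fun h => h.trans hadj.reachable, fun h => h.trans hadj.symm.reachable⟩

theorem edgeProj_eq_zero (h : IsSeparatingPath G u v w) {F : Finset (Sym2 V)}
    (hF : edgeGram (cutGraph G u v w) F ≠ 0) :
    edgeProj (cutGraph G u v w) F v u = 0 ∧ edgeProj (cutGraph G u v w) F v w = 0 :=
  ⟨_root_.edgeProj_eq_zero hF (K := {x | (cutGraph G u v w).Reachable v x})
      (fun _ _ hab => closed hF hab) (SimpleGraph.Reachable.refl v) h.not_reachable,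
    _root_.edgeProj_eq_zero hF (K := {x | (cutGraph G u v w).Reachable v x})
      (fun _ _ hab => closed hF hab) (SimpleGraph.Reachable.refl v)
      fun h' => h.not_reachable (h'.trans h.reachable.symm)⟩

/-- The contribution of a set of edges to the difference of the coefficients. -/
theorem term_nonneg (h : IsSeparatingPath G u v w) (F : Finset (Sym2 V)) (k : ℕ) :
    0 ≤ edgeGram (cutGraph G u v w) F *
        ((if k = F.card then
          lowExcess (edgeProj (cutGraph G u v w) F u u) (edgeProj (cutGraph G u v w) F w w)
            (edgeProj (cutGraph G u v w) F u w) (edgeProj (cutGraph G u v w) F v v) else 0) +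
          if k = F.card + 1 then
            highExcess (edgeProj (cutGraph G u v w) F u u) (edgeProj (cutGraph G u v w) F w w)
            (edgeProj (cutGraph G u v w) F u w) (edgeProj (cutGraph G u v w) F v v) else 0) := by
  by_cases hF : edgeGram (cutGraph G u v w) F = 0
  · rw [hF, zero_mul]
  refine mul_nonneg (edgeGram_nonneg _ _) (add_nonneg ?_ ?_)
  · split_ifs
    · exact lowExcess_nonneg hF h.ne h.not_adj h.not_common
    · exact le_rfl
  · split_ifs
    · exact highExcess_nonneg hF h.ne h.not_adj h.not_common
    · exact le_rfl

theorem coeff_le (h : IsSeparatingPath G u v w) {k : ℕ} (hk : k ≤ Fintype.card V) :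
    signlessLaplacianCoeff (moveEdges G u v w) k ≤ signlessLaplacianCoeff G k := by
  have hd := signlessLaplacianCoeff_sub h.adj_left h.adj_right h.ne h.inter_left h.inter_right
    h.inter_ends (fun F hF => h.edgeProj_eq_zero hF) hk
  have hn := Finset.sum_nonneg fun (F : Finset (Sym2 V)) (_ : F ∈ Finset.univ) =>
    h.term_nonneg F k
  rw [← hd, sub_nonneg] at hn
  exact_mod_cast hn

/-- All terms are nonnegative, so a single edge set with k - 1 elements and positive excess
suffices. -/
theorem coeff_lt (h : IsSeparatingPath G u v w) {k : ℕ} (hk : k ≤ Fintype.card V)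
    {F : Finset (Sym2 V)} (hF : edgeGram (cutGraph G u v w) F ≠ 0) (hcard : k = F.card + 1)
    (hpos : 0 < highExcess (edgeProj (cutGraph G u v w) F u u) (edgeProj (cutGraph G u v w) F w w)
      (edgeProj (cutGraph G u v w) F u w) (edgeProj (cutGraph G u v w) F v v)) :
    signlessLaplacianCoeff (moveEdges G u v w) k < signlessLaplacianCoeff G k := by
  have hd := signlessLaplacianCoeff_sub h.adj_left h.adj_right h.ne h.inter_left h.inter_right
    h.inter_ends (fun F hF => h.edgeProj_eq_zero hF) hk
  have hn := Finset.sum_pos' (fun (F : Finset (Sym2 V)) (_ : F ∈ Finset.univ) =>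
    h.term_nonneg F k) ⟨F, Finset.mem_univ F, by
      rw [if_neg (by omega), if_pos hcard, zero_add]
      exact mul_pos ((edgeGram_nonneg _ _).lt_of_ne' hF) hpos⟩
  rw [← hd, sub_pos] at hn
  exact_mod_cast hn

theorem coeff_lt_of_two_le (h : IsSeparatingPath G u v w) {k : ℕ} (hk2 : 2 ≤ k)
    (hk : k < Fintype.card V) :
    signlessLaplacianCoeff (moveEdges G u v w) k < signlessLaplacianCoeff G k := by
  obtain ⟨x, hx⟩ := h.reachable.exists_adj h.ne
  have hxv : x ≠ v := by
    rintro rfl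
    exact h.not_reachable hx.symm.reachable
  have huv := h.adj_left.ne
  -- The coordinate vectors of u and v settle one component each, leaving n - 2 edges for a basis.
  -- Starting from the edge ux will force Π_uu < 1, and independence from the coordinate vector of u
  -- gives Π_uu ≠ 0; both pass to subsets of size k - 1 containing ux.
  obtain ⟨F₁, hA, hcard, hind⟩ := exists_edges_extension (H := cutGraph G u v w) {u, v}
    {s(u, x)} (by simpa using hx) (by
      have he : (Sum.inl '' (({u, v} : Finset V) : Set V) ∪
          Sum.inr '' (({s(u, x)} : Finset (Sym2 V)) : Set (Sym2 V)) : Set (V ⊕ Sym2 V)) =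
          insert (Sum.inr s(u, x)) (insert (Sum.inl u) (insert (Sum.inl v) ∅)) := by
        ext z
        rcases z with z | z <;> simp
      rw [he]
      refine (((linearIndepOn_empty _ _).insert ?_).insert ?_).insert ?_
      · exact notMem_span_of_functional (x := v) (by simp) (by simp [vertexEdgeVector])
      · exact notMem_span_of_functional (x := u) (by simp [vertexEdgeVector, huv])
          (by simp [vertexEdgeVector])
      · exact notMem_span_of_functional (x := x) (by simp [vertexEdgeVector, hx.ne', hxv])
          (by simp [vertexEdgeVector, realInc_apply hx, hx.ne']))
    (fun y h0 hy => h.eq_zero hy (h0 u (by simp)) (h0 v (by simp)))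
  rw [Finset.card_pair huv] at hcard
  obtain ⟨F, hAF, hFF, hFc⟩ := Finset.exists_subsuperset_card_eq hA
    (n := k - 1) (by rw [Finset.card_singleton]; omega) (by omega)
  have hind' : LinearIndepOn ℝ (vertexEdgeVector (cutGraph G u v w))
      (insert (Sum.inl u) (Sum.inr '' (F : Set (Sym2 V)))) := by
    refine hind.mono (Set.insert_subset (Or.inl ⟨u, by simp, rfl⟩) ?_)
    exact Set.Subset.trans (Set.image_mono (Finset.coe_subset.2 hFF)) Set.subset_union_right
  have hF := edgeGram_ne_zero_of_linearIndepOn (hind'.mono (Set.subset_insert _ _))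
  exact h.coeff_lt hk.le hF (by omega) (highExcess_pos hF h.ne h.not_adj h.not_common
    (edgeProj_diag_ne_zero_of_linearIndepOn hind')
    (edgeProj_diag_lt_one hF (hAF (Finset.mem_singleton_self _))))

/-- With a single coordinate vector the basis has n - 1 edges, so the projection has rank one and
`highExcess_pos_of_trace` applies at k = n. -/
theorem coeff_card_lt_of_extension (h : IsSeparatingPath G u v w) {z : V} (hz : z = u ∨ z = v)
    (hspan : ∀ y : V → ℝ, y z = 0 → (∀ a b, (cutGraph G u v w).Adj a b → y a + y b = 0) →
      y = 0) :
    signlessLaplacianCoeff (moveEdges G u v w) (Fintype.card V) <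
      signlessLaplacianCoeff G (Fintype.card V) := by
  obtain ⟨F, -, hcard, hind⟩ := exists_edges_extension (H := cutGraph G u v w) {z} ∅ (by simp) (by
      have he : (Sum.inl '' (({z} : Finset V) : Set V) ∪
          Sum.inr '' ((∅ : Finset (Sym2 V)) : Set (Sym2 V)) : Set (V ⊕ Sym2 V)) =
          insert (Sum.inl z) ∅ := by simp
      rw [he]
      exact (linearIndepOn_empty _ _).insert
        (notMem_span_of_functional (x := z) (by simp) (by simp [vertexEdgeVector])))
    (fun y h0 hy => hspan y (h0 z (by simp)) hy)
  have hind' : LinearIndepOn ℝ (vertexEdgeVector (cutGraph G u v w))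
      (insert (Sum.inl z) (Sum.inr '' (F : Set (Sym2 V)))) :=
    hind.mono (Set.insert_subset (Or.inl ⟨z, by simp, rfl⟩) Set.subset_union_right)
  have hF := edgeGram_ne_zero_of_linearIndepOn (hind'.mono (Set.subset_insert _ _))
  rw [Finset.card_singleton] at hcard
  have hd := edgeProj_diag_ne_zero_of_linearIndepOn hind'
  have htr : (edgeProj (cutGraph G u v w) F).trace = 1 := by
    rw [trace_edgeProj hF, ← hcard]
    push_cast
    ring
  refine h.coeff_lt le_rfl hF hcard.symm (highExcess_pos_of_trace hF h.adj_left.ne h.ne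
    h.adj_right.ne h.not_adj h.not_common htr ?_)
  rcases hz with rfl | rfl
  · exact Or.inl hd
  · exact Or.inr hd

theorem coeff_card_lt_of_odd (h : IsSeparatingPath G u v w) {C : Finset (Sym2 V)}
    (hC : IsCycleOf (cutGraph G u v w) C) (hodd : Odd C.card) :
    signlessLaplacianCoeff (moveEdges G u v w) (Fintype.card V) <
      signlessLaplacianCoeff G (Fintype.card V) := by
  obtain ⟨a, p, hp, rfl⟩ := hC
  rw [List.toFinset_card_of_nodup hp.edges_nodup, SimpleGraph.Walk.length_edges] at hodd
  -- The odd cycle already kills alternating functions on its own component; the coordinate vector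
  -- is placed in the other one.
  rcases cutGraph_reachable_or h.connected h.reachable a with ha | ha
  · exact h.coeff_card_lt_of_extension (Or.inr rfl) fun y hv hy =>
      h.eq_zero hy (eq_zero_of_reachable hy ha.symm (eq_zero_of_odd_closed hy p hodd)) hv
  · exact h.coeff_card_lt_of_extension (Or.inl rfl) fun y hu hy =>
      h.eq_zero hy hu (eq_zero_of_reachable hy ha.symm (eq_zero_of_odd_closed hy p hodd))

theorem coeff_card_eq (h : IsSeparatingPath G u v w)
    (heven : ∀ C, IsCycleOf (cutGraph G u v w) C → ¬ Odd C.card) :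
    signlessLaplacianCoeff G (Fintype.card V) =
      signlessLaplacianCoeff (moveEdges G u v w) (Fintype.card V) := by
  classical
  obtain ⟨y, hy1, hy⟩ := exists_alternating heven
  have hd := signlessLaplacianCoeff_sub h.adj_left h.adj_right h.ne h.inter_left h.inter_right
    h.inter_ends (fun F hF => h.edgeProj_eq_zero hF) (le_refl (Fintype.card V))
  -- The sign function restricted to either component contributes at least 1 to the trace n - |F|,
  -- so an independent F has at most n - 2 edges.
  have key : ∀ F : Finset (Sym2 V), Fintype.card V ≤ F.card + 1 →
      edgeGram (cutGraph G u v w) F = 0 := by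
    intro F hcard
    by_contra hF
    have htr := trace_edgeProj hF
    have hle : (Fintype.card V : ℝ) ≤ F.card + 1 := by exact_mod_cast hcard
    set K : Finset V := Finset.univ.filter fun x => (cutGraph G u v w).Reachable v x with hK
    have hyF : ∀ a b, s(a, b) ∈ F → y a + y b = 0 := fun a b hab =>
      hy a b ((SimpleGraph.mem_edgeSet _).1 (mem_edgeSet_of_edgeGram_ne_zero hF hab))
    have h1 := one_le_sum_edgeProj hF (K := K) ⟨v, by simp [hK]⟩
      (y := fun x => if x ∈ K then y x else 0) (fun x hx => by simp [hx, hy1 x])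
      (fun x hx => by simp [hx]) (fun a b hab => by
        have hc : a ∈ K ↔ b ∈ K := by simpa [hK] using closed hF hab
        by_cases ha : a ∈ K
        · simp [ha, hc.1 ha, hyF a b hab]
        · simp [ha, mt hc.2 ha])
    have h2 := one_le_sum_edgeProj hF (K := Kᶜ) ⟨u, by simpa [hK] using h.not_reachable⟩
      (y := fun x => if x ∈ K then 0 else y x)
      (fun x hx => by simp [Finset.mem_compl.1 hx, hy1 x])
      (fun x hx => by simp [not_not.1 (mt Finset.mem_compl.2 hx)]) (fun a b hab => by
        have hc : a ∈ K ↔ b ∈ K := by simpa [hK] using closed hF hab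
        by_cases ha : a ∈ K
        · simp [ha, hc.1 ha]
        · simp [ha, mt hc.2 ha, hyF a b hab])
    have hsum : (edgeProj (cutGraph G u v w) F).trace =
        ∑ x ∈ K, edgeProj (cutGraph G u v w) F x x +
          ∑ x ∈ Kᶜ, edgeProj (cutGraph G u v w) F x x :=
      (Finset.sum_add_sum_compl K _).symm
    linarith
  rw [Finset.sum_eq_zero (fun F _ => ?_), sub_eq_zero] at hd
  · exact_mod_cast hd
  · by_cases hcard : Fintype.card V ≤ F.card + 1
    · rw [key F hcard, zero_mul]
    · rw [if_neg (by omega), if_neg (by omega), add_zero, mul_zero]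

end IsSeparatingPath

/-! ### The main theorem -/

theorem theorem3p4 {V : Type*} [Fintype V] [DecidableEq V] (G : SimpleGraph V)
    (hG : G.Connected)
    -- the cycles `C₁, C₂, …` under consideration: those of minimal lengths
    (B : Finset (Finset (Sym2 V))) (hB : IsMinimumCycleBasis G B)
    (C₁ : Finset (Sym2 V)) (hC₁ : IsCycleOf G C₁) (hlen : 5 ≤ C₁.card)
    (u v w : V) (huv : s(u, v) ∈ C₁) (hvw : s(v, w) ∈ C₁)
    (hNuv : G.neighborSet u ∩ G.neighborSet v = ∅)
    (hNvw : G.neighborSet v ∩ G.neighborSet w = ∅)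
    (hNuw : G.neighborSet u ∩ G.neighborSet w = {v})
    (h1 : ∀ C ∈ B, C ≠ C₁ → (cycleVerts C₁ ∩ cycleVerts C).card ≤ 2 →
      (({u, v, w} : Finset V) ∩ cycleVerts C).card = 0 ∨
      (({u, v, w} : Finset V) ∩ cycleVerts C).card = 1)
    (h2 : ∀ C ∈ B, C ≠ C₁ → (cycleVerts C₁ ∩ cycleVerts C).card = 3 →
      (({u, v, w} : Finset V) ∩ cycleVerts C).card = 0 ∨
      (({u, v, w} : Finset V) ∩ cycleVerts C).card = 3)
    (h3 : ∀ C ∈ B, C ≠ C₁ → 4 ≤ (cycleVerts C₁ ∩ cycleVerts C).card →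
      (({u, v, w} : Finset V) ∩ cycleVerts C).card = 3) :
    -- the cycle becomes shorter by two
    (∃ C₁', IsCycleOf (moveEdges G u v w) C₁' ∧
      cycleVerts C₁' = cycleVerts C₁ \ {v, w} ∧ C₁'.card + 2 = C₁.card) ∧
    ∀ i ≤ Fintype.card V,
      signlessLaplacianCoeff (moveEdges G u v w) i ≤ signlessLaplacianCoeff G i ∧
      (signlessLaplacianCoeff G i = signlessLaplacianCoeff (moveEdges G u v w) i ↔
        i = 0 ∨ i = 1 ∨
          (i = Fintype.card V ∧ ∀ C, IsCycleOf G C → Odd C.card → s(u, v) ∈ C)) := by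
  have huvA : G.Adj u v := (hC₁.mono le_rfl).2 _ huv
  have hvwA : G.Adj v w := (hC₁.mono le_rfl).2 _ hvw
  -- If w = u, then v would be the only neighbour of u; but u lies on a cycle through uv and so has
  -- a further neighbour.
  have huw : u ≠ w := by
    rintro rfl
    obtain ⟨y, hy⟩ := (hC₁.reachable_deleteEdges huv).exists_adj huvA.ne
    rw [SimpleGraph.deleteEdges_adj] at hy
    have : y ∈ G.neighborSet u ∩ G.neighborSet u := ⟨hy.1, hy.1⟩
    rw [hNuw] at this
    obtain rfl := this
    exact hy.2 rfl
  have hnadj : ¬ G.Adj u w := fun h => by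
    have : w ∈ G.neighborSet u ∩ G.neighborSet v := ⟨h, hvwA⟩
    rw [hNuv] at this
    exact this
  -- A basis cycle other than C₁ meets {u, v, w} in at most one vertex, and then contains neither
  -- edge, or in all three, and then contains both since it has no chord.
  have hbasis : ∀ C ∈ B, s(u, v) ∈ C ↔ s(v, w) ∈ C := by
    intro C hC
    by_cases hCC : C = C₁
    · rw [hCC]
      exact iff_of_true huv hvw
    have hcases : (({u, v, w} : Finset V) ∩ cycleVerts C).card ≤ 1 ∨
        (({u, v, w} : Finset V) ∩ cycleVerts C).card = 3 := by
      have e1 := h1 C hC hCC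
      have e2 := h2 C hC hCC
      have e3 := h3 C hC hCC
      omega
    rcases hcases with hle | h3'
    · have hno : ∀ a b, a ≠ b → a ∈ ({u, v, w} : Finset V) → b ∈ ({u, v, w} : Finset V) →
          s(a, b) ∉ C := by
        intro a b hab ha hb hmem
        obtain ⟨ha', hb'⟩ := mem_cycleVerts hmem
        exact hab (Finset.card_le_one.1 hle a (Finset.mem_inter.2 ⟨ha, ha'⟩) b
          (Finset.mem_inter.2 ⟨hb, hb'⟩))
      exact iff_of_false (hno u v huvA.ne (by simp) (by simp))
        (hno v w hvwA.ne (by simp) (by simp))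
    · have hsub : ({u, v, w} : Finset V) ⊆ cycleVerts C := by
        have : ({u, v, w} : Finset V) ∩ cycleVerts C = {u, v, w} :=
          Finset.eq_of_subset_of_card_le Finset.inter_subset_left
            (by rw [h3']; exact Finset.card_le_three)
        exact Finset.inter_eq_left.1 this
      have hu : u ∈ cycleVerts C := hsub (by simp)
      have hv : v ∈ cycleVerts C := hsub (by simp)
      have hw : w ∈ cycleVerts C := hsub (by simp)
      exact iff_of_true (hB.mem_of_adj hC hu hv huvA) (hB.mem_of_adj hC hv hw hvwA)
  have hcyc : ∀ C, IsCycleOf G C → (s(u, v) ∈ C ↔ s(v, w) ∈ C) :=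
    fun C hC => hB.1.mem_iff_mem hbasis hC
  have hnr : ¬ (cutGraph G u v w).Reachable u v :=
    not_reachable_deleteEdges_pair huvA (by
      intro h
      rcases Sym2.eq_iff.1 h with ⟨h, -⟩ | ⟨h, -⟩
      · exact huvA.ne h
      · exact huw h) fun C hC h => (hcyc C hC).1 h
  have hsep : IsSeparatingPath G u v w :=
    ⟨hG, huvA, hvwA, huw, hNuv, hNvw, hNuw, fun h => hnr h.symm, cutGraph_reachable hnr hC₁ huv⟩
  refine ⟨exists_shortened_cycle hC₁ huv hvw huw hNuw hnadj, fun i hi => ⟨hsep.coeff_le hi, ?_⟩⟩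
  constructor
  · intro heq
    by_contra hno
    push Not at hno
    obtain ⟨hi0, hi1, hin⟩ := hno
    rcases hi.lt_or_eq with hlt | rfl
    · exact (hsep.coeff_lt_of_two_le (by omega) hlt).ne heq.symm
    · obtain ⟨C, hC, hodd, hnot⟩ := hin rfl
      -- An odd cycle that avoids uv also avoids vw, so it survives in `cutGraph`.
      refine (hsep.coeff_card_lt_of_odd (hC.of_edges_mem fun e he => ?_) hodd).ne heq.symm
      rw [SimpleGraph.edgeSet_deleteEdges]
      refine ⟨(hC.mono le_rfl).2 e he, ?_⟩
      rintro (rfl | rfl)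
      · exact hnot he
      · exact hnot ((hcyc C hC).2 he)
  · rintro (rfl | rfl | ⟨rfl, hall⟩)
    · rw [signlessLaplacianCoeff_zero, signlessLaplacianCoeff_zero]
    · exact signlessLaplacianCoeff_one_moveEdges huvA hvwA huw hNuv hNvw hNuw
    · refine hsep.coeff_card_eq fun C hC hodd => ?_
      obtain ⟨hCG, hmem⟩ := hC.mono (SimpleGraph.deleteEdges_le _)
      have := hmem _ (hall C hCG hodd)
      rw [SimpleGraph.edgeSet_deleteEdges] at this
      exact this.2 (Or.inl rfl)
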